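/- Let $Y$ be a real random variable and $X$ a random vector in $\mathbb{R}^p$ on a common probability space with $E(Y^2)<\infty$, $E(\|X\|^2)<\infty$, $V(Y)>0$, $V(X)$ non-singular, and $E(Y|X)=\alpha_0+X'\beta_0$ for some $(\alpha_0,\beta_0)\in\mathbb{R}\times\mathbb{R}^p$. For an integrable random variable $A$ write $A_0=A-E(A)$ and let $F_A$ be its cdf when $A$ is real-valued. The identified set of $\beta_0$, when only the marginal distributions of $X$ and $Y$ are known, is $$\mathcal{B}=\left\{\beta\in\mathbb{R}^p:\ \exists \text{ random variables } (\widetilde X,\widetilde Y) \text{ with } \widetilde X\overset{d}{=}X,\ \widetilde Y\overset{d}{=}Y,\ E(\widetilde Y_0|\widetilde X_0)=\widetilde X_0'\beta\right\},$$ and the identified set of the component $\beta_{0k}$ is $\mathcal{B}_k=\{\beta_k:\beta\in\mathcal{B}\}$. Let $\sigma(q)=\sup_{b\in\mathcal{B}}q'b$ be the support function of $\mathcal{B}$. For a cdf $F$ let $F^{-1}(t)=\inf\{x: F(x)\ge t\}$ and, for cdfs $F,G$ of mean-zero distributions, let $$S(F,G)=\inf_{\alpha\in(0,1)}\frac{\int_\alpha^1F^{-1}(t)\,dt}{\int_\alpha^1G^{-1}(t)\,dt}.$$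 Let $e_k$ be the $k$-th canonical basis vector of $\mathbb{R}^p$, and use the conventions $1/0=\infty$, $1/\infty=0$. Then, for every $k\in\{1,\dots,p\}$, $\mathcal{B}_k$ is the compact interval $[-\sigma(-e_k),\,\sigma(e_k)]$, and $$\sigma(e_k)=\frac{1}{\inf_{q\in\mathbb{R}^p:\,q_k=1}1/S(F_{Y_0},F_{X_0'q})},\qquad \sigma(-e_k)=\frac{1}{\inf_{q\in\mathbb{R}^p:\,q_k=-1}1/S(F_{Y_0},F_{X_0'q})}.$$ Moreover each of the two infima is an unconstrained convex minimization over $\mathbb{R}^{p-1}$: it is the infimum over the $p-1$ free coordinates $(q_j)_{j\ne k}\in\mathbb{R}^{p-1}$ of the function $(q_j)_{j\neq k}\mapsto 1/S(F_{Y_0},F_{X_0'q})\in[0,\infty]$ (with $q_k=1$, respectively $q_k=-1$), and this function is convex. -/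

import Mathlib

open MeasureTheory ProbabilityTheory
open scoped NNReal ENNReal

namespace DataCombination

/-- The centered version `A₀ = A - E(A)` of a random vector `A`. -/
noncomputable def centered {Ω E : Type*} [MeasurableSpace Ω] [NormedAddCommGroup E]
    [NormedSpace ℝ E] (P : Measure Ω) (A : Ω → E) : Ω → E :=
  fun ω => A ω - ∫ ω', A ω' ∂P

/-- The cumulative distribution function `F_A` of a real random variable `A`. -/
noncomputable def cdfOf {Ω : Type*} [MeasurableSpace Ω] (P : Measure Ω) (A : Ω → ℝ) : ℝ → ℝ :=
  fun x => cdf (P.map A) x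

/-- The generalized inverse `F⁻¹(t) = inf {x : F x ≥ t}` of a cumulative distribution function. -/
noncomputable def quantile (F : ℝ → ℝ) (t : ℝ) : ℝ := sInf {x : ℝ | t ≤ F x}

/-- The ratio of superquantiles `R(α, F, G)`. -/
noncomputable def superquantileRatio (α : ℝ) (F G : ℝ → ℝ) : ℝ :=
  (∫ t in α..1, quantile F t) / (∫ t in α..1, quantile G t)

/-- `S(F, G)`, the infimum of `R(α, F, G)` over `0 < α < 1`. -/
noncomputable def radial (F G : ℝ → ℝ) : ℝ :=
  ⨅ α : Set.Ioo (0 : ℝ) 1, superquantileRatio α F G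

/-- The covariance matrix `V(X)` of a random vector. -/
noncomputable def covMatrix {Ω : Type*} [MeasurableSpace Ω] {p : ℕ} (P : Measure Ω)
    (X : Ω → EuclideanSpace ℝ (Fin p)) : Matrix (Fin p) (Fin p) ℝ :=
  Matrix.of fun i j => covariance (fun ω => X ω i) (fun ω => X ω j) P

/-- The identified set `B`: all `β` for which there are random variables `X'`, `Y'`, defined on a
common probability space, with the given marginal laws and with `E(Y'₀ | X'₀) = β ⬝ X'₀` almost
surely. -/
def identifiedSet {p : ℕ} (PX : Measure (EuclideanSpace ℝ (Fin p))) (PY : Measure ℝ) :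
    Set (EuclideanSpace ℝ (Fin p)) :=
  {β | ∃ (Ω' : Type) (_ : MeasurableSpace Ω') (Q : Measure Ω')
      (X' : Ω' → EuclideanSpace ℝ (Fin p)) (Y' : Ω' → ℝ),
      IsProbabilityMeasure Q ∧ Measurable X' ∧ Measurable Y' ∧
      Q.map X' = PX ∧ Q.map Y' = PY ∧
      Q[centered Q Y' | MeasurableSpace.comap (centered Q X') inferInstance]
        =ᵐ[Q] fun ω => inner ℝ β (centered Q X' ω)}

/-- The identified set `B_k` of the `k`-th component. -/
def componentSet {p : ℕ} (B : Set (EuclideanSpace ℝ (Fin p))) (k : Fin p) : Set ℝ :=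
  {b | ∃ β ∈ B, β k = b}

/-- The support function `σ(q) = sup {q ⬝ b : b ∈ B}` of `B`, as an extended real number. -/
noncomputable def supportFn {p : ℕ} (B : Set (EuclideanSpace ℝ (Fin p)))
    (q : EuclideanSpace ℝ (Fin p)) : EReal :=
  ⨆ b ∈ B, ((inner ℝ q b : ℝ) : EReal)

/-- `q ↦ 1 / S(F_{Y₀}, F_{X₀ ⬝ q})`, with values in `[0, ∞]` and the convention `1 / 0 = ∞`. -/
noncomputable def invRadial {Ω : Type*} [MeasurableSpace Ω] {p : ℕ} (P : Measure Ω)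
    (X : Ω → EuclideanSpace ℝ (Fin p)) (Y : Ω → ℝ) (q : EuclideanSpace ℝ (Fin p)) : ℝ≥0∞ :=
  (ENNReal.ofReal
    (radial (cdfOf P (centered P Y)) (cdfOf P fun ω => inner ℝ q (centered P X ω))))⁻¹

/-- The vector of `ℝ^p` with `k`-th coordinate `c` and with its other `p - 1` coordinates given
by `x`. -/
noncomputable def fillCoord {p : ℕ} (k : Fin p) (c : ℝ) (x : {j : Fin p // j ≠ k} → ℝ) :
    EuclideanSpace ℝ (Fin p) :=
  WithLp.toLp 2 fun j => if h : j = k then c else x ⟨j, h⟩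

end DataCombination

namespace DataCombination

open Set Filter Topology

/-! Membership of `β` in the identified set is a convex-order condition: a coupling with `E(Y₀ | X₀)
= β ⬝ X₀` exists exactly when every superquantile integral of `β ⬝ X₀` is at most that of `Y₀`
(`mem_identifiedSet_iff`). Necessity is conditional Jensen, applied through the variational formula
`∫_α^1 F⁻¹ = min_c {c (1 - α) + E(Z - c)⁺}`. Sufficiency is Strassen's theorem on the line, made
explicit by the inverse transform martingale coupling (`exists_martingale_coupling`). That coupling
is lifted from `β ⬝ X₀` to `X` by a kernel that depends on `X` only through `β ⬝ X₀`
(`exists_kernel_of_martingale`).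

The variational formula also makes the superquantile integral of `q ⬝ X₀` sublinear in `q`, and
nonsingularity of `V(X)` makes it positive for `q ≠ 0`. The identified set is thus an intersection
of sublevel sets of sublinear functionals: convex, compact, containing `0`, with `S` as its radial
function. The rest is convex geometry. A point with `±β_k > 0` is a positive multiple of a point of
the hyperplane `q_k = ±1`, so `σ(±e_k)` is the supremum of `S` there (`supportFn_sublevelSet`),
while `1/S` is a supremum of sublinear functions, hence convex (`convexOn_inv_ofReal_radialFn`). -/

/-- The superquantile integral `∫_α^1 F_m⁻¹` of a law `m`. -/
noncomputable def superquantile (m : Measure ℝ) (α : ℝ) : ℝ :=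
  ∫ t in α..1, quantile (cdf m) t

/-- The quantile function of `m`, set to `0` outside `(0, 1)`. -/
noncomputable def unitQuantile (m : Measure ℝ) : ℝ → ℝ :=
  (Ioo (0 : ℝ) 1).indicator (quantile (cdf m))

/-- The uniform law on `(0, 1)`. -/
noncomputable def uniform : Measure ℝ := volume.restrict (Ioo (0 : ℝ) 1)

instance : IsProbabilityMeasure uniform := ⟨by simp [uniform]⟩

/-! ### Quantile functions and the variational formula for superquantiles -/

section Quantile

variable (m : Measure ℝ)

/-- Right continuity of the cdf puts the infimum itself in the set. For `t` in `(0, 1)` the limits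
of the cdf at `±∞` make that set nonempty and bounded below, so `sInf` takes no default value. -/
lemma quantile_le_iff {t x : ℝ} (ht : t ∈ Ioo (0 : ℝ) 1) :
    quantile (cdf m) t ≤ x ↔ t ≤ cdf m x := by
  have hne : {x : ℝ | t ≤ cdf m x}.Nonempty :=
    ((tendsto_cdf_atTop m).eventually (eventually_ge_nhds ht.2)).exists
  have hbdd : BddBelow {x : ℝ | t ≤ cdf m x} := by
    obtain ⟨b, hb⟩ := ((tendsto_cdf_atBot m).eventually (eventually_lt_nhds ht.1)).exists
    refine ⟨b, fun y hy => ?_⟩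
    by_contra! h
    exact absurd (hy.trans (monotone_cdf m h.le)) (not_le.2 hb)
  refine ⟨fun h => ?_, fun h => csInf_le hbdd h⟩
  refine le_trans ?_ (monotone_cdf m h)
  have hc := ((cdf m).right_continuous (quantile (cdf m) t)).mono Ioi_subset_Ici_self
  refine ge_of_tendsto hc ?_
  filter_upwards [self_mem_nhdsWithin] with y hy
  obtain ⟨z, hz, hzy⟩ := exists_lt_of_csInf_lt hne (show sInf {x : ℝ | t ≤ cdf m x} < y from hy)
  exact le_trans hz (monotone_cdf m hzy.le)

lemma unitQuantile_of_mem {t : ℝ} (ht : t ∈ Ioo (0 : ℝ) 1) :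
    unitQuantile m t = quantile (cdf m) t := indicator_of_mem ht _

lemma unitQuantile_le_iff {t x : ℝ} (ht : t ∈ Ioo (0 : ℝ) 1) :
    unitQuantile m t ≤ x ↔ t ≤ cdf m x := by
  rw [unitQuantile_of_mem m ht, quantile_le_iff m ht]

lemma superquantile_eq_setIntegral {m : Measure ℝ} {α : ℝ} (hα : α ∈ Ioo (0 : ℝ) 1) :
    superquantile m α = ∫ t in Ioi α, unitQuantile m t ∂uniform := by
  rw [superquantile, intervalIntegral.integral_of_le hα.2.le, uniform,
    Measure.restrict_restrict measurableSet_Ioi,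
    setIntegral_congr_set (Ioo_ae_eq_Ioc (a := α) (b := (1 : ℝ))).symm]
  have : Ioi α ∩ Ioo 0 1 = Ioo α 1 := by
    ext t; simp only [mem_inter_iff, mem_Ioi, mem_Ioo]
    exact ⟨fun h => ⟨h.1, h.2.2⟩, fun h => ⟨h.1, hα.1.trans h.1, h.2⟩⟩
  rw [this]
  refine setIntegral_congr_fun measurableSet_Ioo fun t ht => ?_
  exact (unitQuantile_of_mem m ⟨hα.1.trans ht.1, ht.2⟩).symm

lemma monotoneOn_unitQuantile : MonotoneOn (unitQuantile m) (Ioo 0 1) := by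
  intro s hs t ht hst
  rw [unitQuantile_le_iff m hs]
  exact hst.trans ((unitQuantile_le_iff m ht).1 le_rfl)

@[fun_prop]
lemma measurable_unitQuantile : Measurable (unitQuantile m) := by
  refine measurable_of_Iic fun x => ?_
  have h : unitQuantile m ⁻¹' Iic x =
      (Ioo 0 1 ∩ Iic (cdf m x)) ∪ ((Ioo 0 1)ᶜ ∩ {_t | (0 : ℝ) ≤ x}) := by
    ext t
    by_cases ht : t ∈ Ioo (0 : ℝ) 1
    · simp only [mem_preimage, mem_Iic, unitQuantile_le_iff m ht, mem_union, mem_inter_iff, ht,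
        mem_compl_iff, true_and, not_true, false_and, or_false]
    · simp only [mem_preimage, mem_Iic, unitQuantile, indicator_of_notMem ht, mem_union,
        mem_inter_iff, ht, mem_compl_iff, false_and, not_false_iff, true_and, false_or,
        mem_ofPred_eq]
  rw [h]
  exact (measurableSet_Ioo.inter measurableSet_Iic).union
    (measurableSet_Ioo.compl.inter (MeasurableSet.const _))

variable [IsProbabilityMeasure m]

lemma map_unitQuantile : uniform.map (unitQuantile m) = m := by
  have : IsProbabilityMeasure (uniform.map (unitQuantile m)) :=
    Measure.isProbabilityMeasure_map (measurable_unitQuantile m).aemeasurable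
  refine Measure.ext_of_Iic _ _ fun x => ?_
  rw [Measure.map_apply (measurable_unitQuantile m) measurableSet_Iic, ← ofReal_cdf m x, uniform,
    Measure.restrict_apply (measurable_unitQuantile m measurableSet_Iic)]
  have h : unitQuantile m ⁻¹' Iic x ∩ Ioo 0 1 = Iic (cdf m x) ∩ Ioo 0 1 := by
    ext t
    refine and_congr_left fun ht => ?_
    exact unitQuantile_le_iff m ht
  have h2 : (Iic (cdf m x) ∩ Ioo 0 1 : Set ℝ) =ᵐ[volume] (Iic (cdf m x) ∩ Ioc 0 1 : Set ℝ) :=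
    EventuallyEq.inter ae_eq_rfl Ioo_ae_eq_Ioc
  have h3 : (Iic (cdf m x) ∩ Ioc 0 1 : Set ℝ) = Ioc 0 (cdf m x) := by
    ext t
    have := cdf_le_one m x
    simp only [mem_inter_iff, mem_Iic, mem_Ioc]
    constructor
    · rintro ⟨h1, h2, _⟩; exact ⟨h2, h1⟩
    · rintro ⟨h1, h2⟩; exact ⟨h2, h1, h2.trans this⟩
  rw [h, measure_congr h2, h3, Real.volume_Ioc, sub_zero]

variable {m}

lemma integrable_unitQuantile (hm : Integrable (fun x => x) m) :
    Integrable (unitQuantile m) uniform := by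
  have h := hm
  rw [← map_unitQuantile m] at h
  exact h.comp_measurable (measurable_unitQuantile m)

lemma integral_unitQuantile : ∫ t, unitQuantile m t ∂uniform = ∫ x, x ∂m := by
  conv_rhs => rw [← map_unitQuantile m]
  rw [integral_map (measurable_unitQuantile m).aemeasurable (by fun_prop)]

lemma uniform_real_Ioi {α : ℝ} (hα : α ∈ Ioo (0 : ℝ) 1) : uniform.real (Ioi α) = 1 - α := by
  have : Ioi α ∩ Ioo 0 1 = Ioo α 1 := by
    ext t; simp only [mem_inter_iff, mem_Ioi, mem_Ioo]
    exact ⟨fun h => ⟨h.1, h.2.2⟩, fun h => ⟨h.1, hα.1.trans h.1, h.2⟩⟩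
  rw [uniform, measureReal_restrict_apply measurableSet_Ioi, this, Real.volume_real_Ioo_of_le hα.2.le]

lemma integral_posPart_unitQuantile (c : ℝ) :
    ∫ t, max (unitQuantile m t - c) 0 ∂uniform = ∫ x, max (x - c) 0 ∂m := by
  conv_rhs => rw [← map_unitQuantile m]
  rw [integral_map (measurable_unitQuantile m).aemeasurable (by fun_prop)]

lemma integrable_posPart_unitQuantile (hm : Integrable (fun x => x) m) (c : ℝ) :
    Integrable (fun t => max (unitQuantile m t - c) 0) uniform :=
  ((integrable_unitQuantile hm).sub (integrable_const c)).pos_part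

/-- Since `x ≤ c + (x - c)⁺`, integrating over the tail, of mass `1 - α`, gives the bound for every
`c`. With `exists_superquantile_eq` it replaces quantiles by expectations in all later arguments. -/
lemma superquantile_le (hm : Integrable (fun x => x) m) {α : ℝ} (hα : α ∈ Ioo (0 : ℝ) 1) (c : ℝ) :
    superquantile m α ≤ c * (1 - α) + ∫ x, max (x - c) 0 ∂m := by
  have hi := integrable_posPart_unitQuantile hm c
  have h1 : ∫ t in Ioi α, (c + max (unitQuantile m t - c) 0) ∂uniform
      = c * (1 - α) + ∫ t in Ioi α, max (unitQuantile m t - c) 0 ∂uniform := by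
    rw [integral_add (integrable_const c) hi.restrict]
    simp [uniform_real_Ioi hα, mul_comm]
  calc superquantile m α = ∫ t in Ioi α, unitQuantile m t ∂uniform := superquantile_eq_setIntegral hα
    _ ≤ ∫ t in Ioi α, (c + max (unitQuantile m t - c) 0) ∂uniform := by
        refine integral_mono (integrable_unitQuantile hm).restrict
          ((integrable_const c).add hi.restrict) fun t => ?_
        have := le_max_left (unitQuantile m t - c) 0
        simp only; linarith
    _ = _ := h1
    _ ≤ _ := by
        rw [← integral_posPart_unitQuantile c]
        have h0 : 0 ≤ᵐ[uniform] fun t => max (unitQuantile m t - c) 0 :=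
          ae_of_all _ fun t => le_max_right (unitQuantile m t - c) 0
        exact add_le_add le_rfl (setIntegral_le_integral hi h0)

lemma exists_superquantile_eq (hm : Integrable (fun x => x) m) {α : ℝ}
    (hα : α ∈ Ioo (0 : ℝ) 1) :
    ∃ c, superquantile m α = c * (1 - α) + ∫ x, max (x - c) 0 ∂m := by
  -- By monotonicity the `α`-quantile makes both inequalities of `superquantile_le` tight: the
  -- positive part vanishes below `α` and equals the difference above.
  set c := unitQuantile m α
  have hi := integrable_posPart_unitQuantile hm c
  refine ⟨c, ?_⟩
  have hae : ∀ᵐ t ∂uniform, t ∈ Ioo (0 : ℝ) 1 := ae_restrict_mem measurableSet_Ioo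
  have hle : ∀ᵐ t ∂uniform, t ∈ (Ioi α)ᶜ → max (unitQuantile m t - c) 0 = 0 := by
    filter_upwards [hae] with t ht hta
    exact max_eq_right (sub_nonpos.2 (monotoneOn_unitQuantile m ht hα (not_lt.1 hta)))
  have h0 : ∫ t in (Ioi α)ᶜ, max (unitQuantile m t - c) 0 ∂uniform = 0 :=
    integral_eq_zero_of_ae ((ae_restrict_iff' measurableSet_Ioi.compl).2 hle)
  rw [← integral_posPart_unitQuantile c, ← integral_add_compl measurableSet_Ioi hi, h0, add_zero,
    superquantile_eq_setIntegral hα]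
  have h1 : ∫ t in Ioi α, (c + max (unitQuantile m t - c) 0) ∂uniform
      = c * (1 - α) + ∫ t in Ioi α, max (unitQuantile m t - c) 0 ∂uniform := by
    rw [integral_add (integrable_const c) hi.restrict]
    simp [uniform_real_Ioi hα, mul_comm]
  rw [← h1]
  refine integral_congr_ae ((ae_restrict_iff' measurableSet_Ioi).2 ?_)
  filter_upwards [hae] with t ht hta
  rw [max_eq_left (sub_nonneg.2 (monotoneOn_unitQuantile m hα ht (le_of_lt hta)))]
  ring

end Quantile

/-! ### Martingale couplings on the line -/

section Coupling

/-- Two finite measures on the line with the same mass, the first stochastically smaller than the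
second, have a coupling carried by `{x ≤ y}`. -/
lemma exists_ordered_coupling (a b : Measure ℝ) [IsFiniteMeasure a] [IsFiniteMeasure b]
    (hab : a univ = b univ) (hle : ∀ u, b (Iic u) ≤ a (Iic u)) :
    ∃ π : Measure (ℝ × ℝ), IsFiniteMeasure π ∧ π.map Prod.fst = a ∧ π.map Prod.snd = b ∧
      ∀ᵐ z ∂π, z.1 ≤ z.2 := by
  by_cases h0 : a univ = 0
  · refine ⟨0, inferInstance, ?_, ?_, by simp⟩
    · rw [Measure.measure_univ_eq_zero.1 h0, Measure.map_zero]
    · rw [Measure.measure_univ_eq_zero.1 (hab.symm.trans h0), Measure.map_zero]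
  have htop : a univ ≠ ∞ := measure_ne_top _ _
  set c := a univ with hc
  have key : ∀ m : Measure ℝ, m univ = c →
      IsProbabilityMeasure (c⁻¹ • m) ∧ c • (c⁻¹ • m) = m := fun m hm =>
    ⟨⟨by simp [hm, ENNReal.inv_mul_cancel h0 htop]⟩,
      by rw [smul_smul, ENNReal.mul_inv_cancel h0 htop, one_smul]⟩
  obtain ⟨ha, ha'⟩ := key a rfl
  obtain ⟨hb, hb'⟩ := key b hab.symm
  set a' := c⁻¹ • a
  set b' := c⁻¹ • b
  -- Comonotone coupling of the normalized measures: stochastic order is pointwise order of the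
  -- quantile functions.
  have hT : Measurable fun t => (unitQuantile a' t, unitQuantile b' t) := by fun_prop
  refine ⟨c • uniform.map (fun t => (unitQuantile a' t, unitQuantile b' t)), ?_, ?_, ?_, ?_⟩
  · exact Measure.smul_finite _ htop
  · rw [Measure.map_smul, Measure.map_map measurable_fst hT]
    exact (congrArg (c • ·) (map_unitQuantile a')).trans ha'
  · rw [Measure.map_smul, Measure.map_map measurable_snd hT]
    exact (congrArg (c • ·) (map_unitQuantile b')).trans hb'
  · refine Measure.ae_smul_measure ?_ c
    rw [ae_map_iff hT.aemeasurable (measurableSet_le measurable_fst measurable_snd)]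
    filter_upwards [ae_restrict_mem measurableSet_Ioo] with t ht
    change unitQuantile a' t ≤ unitQuantile b' t
    rw [unitQuantile_le_iff a' ht]
    refine ((unitQuantile_le_iff b' ht).1 le_rfl).trans ?_
    rw [cdf_eq_real, cdf_eq_real]
    refine ENNReal.toReal_mono (measure_ne_top _ _) ?_
    simp only [a', b', Measure.smul_apply, smul_eq_mul]
    exact mul_le_mul_right (hle _) _

lemma lintegral_posPart_le_iff {α : Type*} [MeasurableSpace α] {μ : Measure α} {D : α → ℝ}
    (hD : Integrable D μ) :
    ∫⁻ x, ENNReal.ofReal (-D x) ∂μ ≤ ∫⁻ x, ENNReal.ofReal (D x) ∂μ ↔ 0 ≤ ∫ x, D x ∂μ := by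
  rw [integral_eq_lintegral_pos_part_sub_lintegral_neg_part hD, sub_nonneg,
    ENNReal.toReal_le_toReal (by simpa using hD.neg.lintegral_lt_top.ne) hD.lintegral_lt_top.ne]

lemma exists_transport_of_integral_Ioi_nonpos {D : ℝ → ℝ} (hDm : Measurable D)
    (hD : Integrable D uniform) (hmean : ∫ t, D t ∂uniform = 0)
    (htail : ∀ u ∈ Ioo (0 : ℝ) 1, ∫ t in Ioi u, D t ∂uniform ≤ 0) :
    ∃ π : Measure (ℝ × ℝ), IsFiniteMeasure π ∧
      π.map Prod.fst = uniform.withDensity (fun t => ENNReal.ofReal (D t)) ∧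
      π.map Prod.snd = uniform.withDensity (fun t => ENNReal.ofReal (-D t)) ∧
      ∀ᵐ z ∂π, z.1 ≤ z.2 ∧ z.1 ∈ Ioo (0 : ℝ) 1 ∧ z.2 ∈ Ioo (0 : ℝ) 1 ∧ 0 < D z.1 ∧ D z.2 < 0 := by
  -- Zero total mass turns the tail bounds into head bounds, which say that `D⁺` is stochastically
  -- smaller than `D⁻`.
  have hhead : ∀ u, 0 ≤ ∫ t in Iic u, D t ∂uniform := by
    intro u
    have hadd := integral_add_compl (measurableSet_Iic (a := u)) hD
    rw [compl_Iic, hmean] at hadd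
    have hae : ∀ᵐ t ∂uniform, t ∈ Ioo (0 : ℝ) 1 := ae_restrict_mem measurableSet_Ioo
    rcases le_or_gt u 0 with h0 | h0
    · refine (setIntegral_eq_zero_of_ae_eq_zero ?_).ge
      filter_upwards [hae] with t ht htu
      exact absurd (htu.trans h0) (not_le.2 ht.1)
    rcases le_or_gt 1 u with h1 | h1
    · have : ∫ t in Ioi u, D t ∂uniform = 0 := by
        refine setIntegral_eq_zero_of_ae_eq_zero ?_
        filter_upwards [hae] with t ht htu
        exact absurd (h1.trans_lt htu) (not_lt.2 ht.2.le)
      linarith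
    · linarith [htail u ⟨h0, h1⟩]
  have hfa : IsFiniteMeasure (uniform.withDensity fun t => ENNReal.ofReal (D t)) :=
    isFiniteMeasure_withDensity_ofReal hD.2
  have hfb : IsFiniteMeasure (uniform.withDensity fun t => ENNReal.ofReal (-D t)) :=
    isFiniteMeasure_withDensity_ofReal hD.neg.2
  obtain ⟨π, hπ, h1, h2, hle⟩ := exists_ordered_coupling
    (uniform.withDensity fun t => ENNReal.ofReal (D t))
    (uniform.withDensity fun t => ENNReal.ofReal (-D t)) (by
      rw [withDensity_apply _ .univ, withDensity_apply _ .univ, Measure.restrict_univ]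
      refine le_antisymm ?_ ((lintegral_posPart_le_iff hD).2 hmean.ge)
      have := (lintegral_posPart_le_iff hD.neg).2 (by simp [integral_neg, hmean])
      simpa using this) (by
      intro u
      rw [withDensity_apply _ measurableSet_Iic, withDensity_apply _ measurableSet_Iic]
      exact (lintegral_posPart_le_iff hD.restrict).2 (hhead u))
  refine ⟨π, hπ, h1, h2, ?_⟩
  have hae : ∀ᵐ t ∂uniform, t ∈ Ioo (0 : ℝ) 1 := ae_restrict_mem measurableSet_Ioo
  have e1 : ∀ᵐ z ∂π, z.1 ∈ Ioo (0 : ℝ) 1 ∧ 0 < D z.1 := by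
    refine ae_of_ae_map measurable_fst.aemeasurable (p := fun t => t ∈ Ioo (0 : ℝ) 1 ∧ 0 < D t) ?_
    rw [h1, ae_withDensity_iff (by fun_prop)]
    filter_upwards [hae] with t ht hDt
    exact ⟨ht, by simpa using hDt⟩
  have e2 : ∀ᵐ z ∂π, z.2 ∈ Ioo (0 : ℝ) 1 ∧ D z.2 < 0 := by
    refine ae_of_ae_map measurable_snd.aemeasurable (p := fun t => t ∈ Ioo (0 : ℝ) 1 ∧ D t < 0) ?_
    rw [h2, ae_withDensity_iff (by fun_prop)]
    filter_upwards [hae] with t ht hDt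
    exact ⟨ht, by simpa using hDt⟩
  filter_upwards [hle, e1, e2] with z hz h1 h2
  exact ⟨hz, h1.1, h2.1, h1.2, h2.2⟩

/-- The marginal has density `h`, so a weight of at most `1 / h` cancels it. The bound is written `h
* h⁻¹` because this is at most `1` and vanishes where `h` does. -/
lemma withDensity_inv_map_le {π : Measure (ℝ × ℝ)} {h : ℝ → ℝ≥0∞} (hh : Measurable h)
    {pr : ℝ × ℝ → ℝ} (hpr : Measurable pr) {μ : Measure ℝ} (hπ : π.map pr = μ.withDensity h)
    {w : ℝ × ℝ → ℝ≥0∞} (hw : ∀ᵐ z ∂π, w z ≤ (h (pr z))⁻¹) :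
    (π.withDensity w).map pr ≤ μ.withDensity (h * h⁻¹) := by
  rw [withDensity_mul _ hh hh.inv, ← hπ]
  refine Measure.le_iff.2 fun s hs => ?_
  rw [Measure.map_apply hpr hs, withDensity_apply _ (hpr hs), withDensity_apply _ hs,
    setLIntegral_map hs hh.inv hpr]
  exact lintegral_mono_ae (ae_restrict_of_ae hw)

/-- The inverse transform martingale coupling: if `f` is nondecreasing on `(0, 1)` and its tail
integrals are dominated by those of `g`, with the same mean, then there is a martingale coupling
of the laws of `f` and `g` under the uniform law. -/
theorem exists_martingale_coupling {f g : ℝ → ℝ} (hf : Measurable f) (hg : Measurable g)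
    (hfi : Integrable f uniform) (hgi : Integrable g uniform) (hmono : MonotoneOn f (Ioo 0 1))
    (hmean : ∫ t, f t ∂uniform = ∫ t, g t ∂uniform)
    (htail : ∀ u ∈ Ioo (0 : ℝ) 1, ∫ t in Ioi u, f t ∂uniform ≤ ∫ t in Ioi u, g t ∂uniform) :
    ∃ ρ : Measure (ℝ × ℝ), ρ.map Prod.fst = uniform.map f ∧ ρ.map Prod.snd = uniform.map g ∧
      ∀ h : ℝ → ℝ, Measurable h → (∀ x, |h x| ≤ 1) → ∫ z, h z.1 * (z.2 - z.1) ∂ρ = 0 := by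
  obtain ⟨π, hπfin, hπ1, hπ2, hπ⟩ := exists_transport_of_integral_Ioi_nonpos
    (D := fun t => f t - g t) (hf.sub hg) (hfi.sub hgi)
    (by rw [integral_sub hfi hgi, hmean, sub_self])
    (fun u hu => by
      rw [integral_sub hfi.restrict hgi.restrict]; exact sub_nonpos.2 (htail u hu))
  -- On the support of `π`, `g z.1 < f z.1 ≤ f z.2 < g z.2`. Hence `g z.2 - g z.1` is at least `f
  -- z.1 - g z.1` and at least `g z.2 - f z.2`, which bounds both marginals of `κ`.
  set w : ℝ × ℝ → ℝ≥0∞ := fun z => (ENNReal.ofReal (g z.2 - g z.1))⁻¹ with hwdef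
  have hw : Measurable w := by fun_prop
  set κ := π.withDensity w with hκ
  set A := κ.map Prod.fst with hA
  set B := κ.map Prod.snd with hB
  have hAle : A ≤ uniform.withDensity ((fun t => ENNReal.ofReal (f t - g t)) *
      (fun t => ENNReal.ofReal (f t - g t))⁻¹) := by
    refine withDensity_inv_map_le (by fun_prop) measurable_fst hπ1 ?_
    filter_upwards [hπ] with z ⟨hz, h1, h2, h3, h4⟩
    have := hmono h1 h2 hz
    exact ENNReal.inv_le_inv.2 (ENNReal.ofReal_le_ofReal (by linarith))
  have hBle : B ≤ uniform.withDensity ((fun t => ENNReal.ofReal (-(f t - g t))) *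
      (fun t => ENNReal.ofReal (-(f t - g t)))⁻¹) := by
    refine withDensity_inv_map_le (by fun_prop) measurable_snd hπ2 ?_
    filter_upwards [hπ] with z ⟨hz, h1, h2, h3, h4⟩
    have := hmono h1 h2 hz
    exact ENNReal.inv_le_inv.2 (ENNReal.ofReal_le_ofReal (by linarith))
  have hABle : A + B ≤ uniform := by
    refine (add_le_add hAle hBle).trans ?_
    rw [← withDensity_add_left (by fun_prop)]
    refine (withDensity_mono (ae_of_all _ fun t => ?_)).trans_eq withDensity_one
    simp only [Pi.add_apply, Pi.mul_apply, Pi.inv_apply, Pi.one_apply]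
    -- The positive and negative parts of `f - g` are never both nonzero, so the two bounds add up
    -- to at most `1`.
    rcases le_total (f t - g t) 0 with h | h
    · rw [ENNReal.ofReal_of_nonpos h, zero_mul, zero_add]
      exact ENNReal.mul_inv_le_one _
    · rw [ENNReal.ofReal_of_nonpos (neg_nonpos.2 h), zero_mul, add_zero]
      exact ENNReal.mul_inv_le_one _
  have hAfin : IsFiniteMeasure (A + B) := isFiniteMeasure_of_le _ hABle
  set N := uniform - (A + B) with hN
  have hNAB : N + (A + B) = uniform := Measure.sub_add_cancel_of_le hABle
  have hAU : A ≤ uniform := (Measure.le_add_right le_rfl).trans hABle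
  have hBU : B ≤ uniform := (Measure.le_add_left le_rfl).trans hABle
  have hNU : N ≤ uniform := Measure.sub_le
  have hT0 : Measurable fun t => (f t, g t) := by fun_prop
  have hT1 : Measurable fun z : ℝ × ℝ => (f z.1, g z.2) := by fun_prop
  have hT2 : Measurable fun z : ℝ × ℝ => (f z.2, g z.1) := by fun_prop
  have hsplit : ∀ φ : ℝ → ℝ, Measurable φ → uniform.map φ
      = N.map φ + (κ.map (fun z => φ z.1) + κ.map (fun z => φ z.2)) := by
    intro φ hφ
    conv_lhs => rw [← hNAB]
    rw [Measure.map_add _ _ hφ, Measure.map_add _ _ hφ, hA, hB, Measure.map_map hφ measurable_fst,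
      Measure.map_map hφ measurable_snd]
    rfl
  -- Start from the comonotone coupling `(f, g)` and swap the values of `g` between the endpoints of
  -- the pairs drawn from `κ`. The marginals are unchanged, since `N` and the two marginals of `κ`
  -- sum to the uniform law.
  refine ⟨N.map (fun t => (f t, g t)) + (κ.map (fun z => (f z.1, g z.2)) +
    κ.map (fun z => (f z.2, g z.1))), ?_, ?_, ?_⟩
  · rw [Measure.map_add _ _ measurable_fst, Measure.map_add _ _ measurable_fst,
      Measure.map_map measurable_fst hT0, Measure.map_map measurable_fst hT1,
      Measure.map_map measurable_fst hT2, hsplit f hf]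
    rfl
  · rw [Measure.map_add _ _ measurable_snd, Measure.map_add _ _ measurable_snd,
      Measure.map_map measurable_snd hT0, Measure.map_map measurable_snd hT1,
      Measure.map_map measurable_snd hT2, hsplit g hg, add_comm (κ.map fun z => g z.1)]
    rfl
  · intro h hh hbd
    have if1 : Integrable (fun z : ℝ × ℝ => f z.1) κ :=
      (hfi.mono_measure hAU).comp_measurable measurable_fst
    have if2 : Integrable (fun z : ℝ × ℝ => f z.2) κ :=
      (hfi.mono_measure hBU).comp_measurable measurable_snd
    have ig1 : Integrable (fun z : ℝ × ℝ => g z.1) κ :=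
      (hgi.mono_measure hAU).comp_measurable measurable_fst
    have ig2 : Integrable (fun z : ℝ × ℝ => g z.2) κ :=
      (hgi.mono_measure hBU).comp_measurable measurable_snd
    have mulκ : ∀ (u : ℝ × ℝ → ℝ), Measurable u → ∀ v : ℝ × ℝ → ℝ, Integrable v κ →
        Integrable (fun z => h (f (u z)) * v z) κ := fun u hu v hv =>
      hv.bdd_mul (c := 1) (hh.comp (hf.comp hu)).aestronglyMeasurable (ae_of_all _ fun z => hbd _)
    have hφm : Measurable fun t => h (f t) * (g t - f t) := by fun_prop
    have hφ : Integrable (fun t => h (f t) * (g t - f t)) uniform :=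
      (hgi.sub hfi).bdd_mul (c := 1) (hh.comp hf).aestronglyMeasurable (ae_of_all _ fun z => hbd _)
    have hF : Measurable fun z : ℝ × ℝ => h z.1 * (z.2 - z.1) := by fun_prop
    have i0 : Integrable (fun z : ℝ × ℝ => h z.1 * (z.2 - z.1)) (N.map fun t => (f t, g t)) :=
      (integrable_map_measure hF.aestronglyMeasurable hT0.aemeasurable).2 (hφ.mono_measure hNU)
    have j1 : Integrable (fun z => h (f z.1) * (g z.2 - f z.1)) κ :=
      mulκ _ measurable_fst _ (ig2.sub if1)
    have j2 : Integrable (fun z => h (f z.2) * (g z.1 - f z.2)) κ :=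
      mulκ _ measurable_snd _ (ig1.sub if2)
    have j3 : Integrable (fun z => h (f z.1) * (g z.1 - f z.1)) κ :=
      mulκ _ measurable_fst _ (ig1.sub if1)
    have j4 : Integrable (fun z => h (f z.2) * (g z.2 - f z.2)) κ :=
      mulκ _ measurable_snd _ (ig2.sub if2)
    have i1 : Integrable (fun z : ℝ × ℝ => h z.1 * (z.2 - z.1)) (κ.map fun z => (f z.1, g z.2)) :=
      (integrable_map_measure hF.aestronglyMeasurable hT1.aemeasurable).2 j1
    have i2 : Integrable (fun z : ℝ × ℝ => h z.1 * (z.2 - z.1)) (κ.map fun z => (f z.2, g z.1)) :=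
      (integrable_map_measure hF.aestronglyMeasurable hT2.aemeasurable).2 j2
    rw [integral_add_measure i0 (i1.add_measure i2), integral_add_measure i1 i2,
      integral_map hT0.aemeasurable hF.aestronglyMeasurable,
      integral_map hT1.aemeasurable hF.aestronglyMeasurable,
      integral_map hT2.aemeasurable hF.aestronglyMeasurable]
    have hU : ∫ t, h (f t) * (g t - f t) ∂uniform = ∫ t, h (f t) * (g t - f t) ∂N +
        (∫ z, h (f z.1) * (g z.1 - f z.1) ∂κ + ∫ z, h (f z.2) * (g z.2 - f z.2) ∂κ) := by
      conv_lhs => rw [← hNAB]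
      rw [integral_add_measure (hφ.mono_measure hNU)
        ((hφ.mono_measure hAU).add_measure (hφ.mono_measure hBU)),
        integral_add_measure (hφ.mono_measure hAU) (hφ.mono_measure hBU), hA, hB,
        integral_map measurable_fst.aemeasurable hφm.aestronglyMeasurable,
        integral_map measurable_snd.aemeasurable hφm.aestronglyMeasurable]
    have hwtop : ∀ᵐ z ∂π, w z < ∞ ∧ (w z).toReal * (g z.2 - g z.1) = 1 := by
      filter_upwards [hπ] with z ⟨hz, h1, h2, h3, h4⟩
      have := hmono h1 h2 hz
      have hpos : 0 < g z.2 - g z.1 := by linarith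
      refine ⟨ENNReal.inv_lt_top.2 (ENNReal.ofReal_pos.2 hpos), ?_⟩
      simp only [hwdef, ENNReal.toReal_inv, ENNReal.toReal_ofReal hpos.le]
      exact inv_mul_cancel₀ hpos.ne'
    have hdens : ∀ D : ℝ → ℝ, Measurable D → ∫ t, h (f t)
        ∂(uniform.withDensity fun t => ENNReal.ofReal (D t))
        = ∫ t, max (D t) 0 * h (f t) ∂uniform := by
      intro D hD
      rw [integral_withDensity_eq_integral_toReal_smul (by fun_prop) (by simp)]
      rfl
    have hhf : Integrable (fun z : ℝ × ℝ => h (f z.1)) π :=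
      (integrable_const (1 : ℝ)).mono' (hh.comp (hf.comp measurable_fst)).aestronglyMeasurable
        (ae_of_all _ fun z => hbd _)
    have hhf2 : Integrable (fun z : ℝ × ℝ => h (f z.2)) π :=
      (integrable_const (1 : ℝ)).mono' (hh.comp (hf.comp measurable_snd)).aestronglyMeasurable
        (ae_of_all _ fun z => hbd _)
    have hhm : Measurable fun t => h (f t) := by fun_prop
    have hfg : Integrable (fun t => f t - g t) uniform := hfi.sub hgi
    have hgf : Integrable (fun t => -(f t - g t)) uniform := hfg.neg
    have mulU : ∀ v : ℝ → ℝ, Integrable v uniform → Integrable (fun t => v t * h (f t)) uniform :=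
      fun v hv => hv.mul_bdd (c := 1) (hh.comp hf).aestronglyMeasurable (ae_of_all _ fun z => hbd _)
    -- The weight `w` cancels `g z.2 - g z.1`, leaving an integral against the marginals of `π`,
    -- whose difference is `f - g` times the uniform law.
    have hlast : ∫ z, (h (f z.1) - h (f z.2)) * (g z.2 - g z.1) ∂κ
        = -∫ t, h (f t) * (g t - f t) ∂uniform := by
      rw [hκ, integral_withDensity_eq_integral_toReal_smul hw (hwtop.mono fun z hz => hz.1)]
      calc _ = ∫ z, (h (f z.1) - h (f z.2)) ∂π := by
            refine integral_congr_ae (hwtop.mono fun z hz => ?_)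
            simp only [smul_eq_mul]
            linear_combination (h (f z.1) - h (f z.2)) * hz.2
        _ = ∫ t, h (f t) ∂(π.map Prod.fst) - ∫ t, h (f t) ∂(π.map Prod.snd) := by
            rw [integral_sub hhf hhf2, integral_map measurable_fst.aemeasurable
              hhm.aestronglyMeasurable, integral_map measurable_snd.aemeasurable
              hhm.aestronglyMeasurable]
        _ = _ := by
            rw [hπ1, hπ2, hdens _ (by fun_prop), hdens _ (by fun_prop),
              ← integral_sub (mulU _ hfg.pos_part) (mulU _ hgf.pos_part), ← integral_neg]
            refine integral_congr_ae (ae_of_all _ fun t => ?_)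
            simp only
            rcases le_total (f t - g t) 0 with h | h
            · rw [max_eq_right h, max_eq_left (neg_nonneg.2 h)]; ring
            · rw [max_eq_left h, max_eq_right (neg_nonpos.2 h)]; ring
    -- This is the change in the martingale defect caused by the swap; by `hlast` it cancels the
    -- defect of the comonotone coupling.
    have hcomb : ∫ z, (h (f z.1) - h (f z.2)) * (g z.2 - g z.1) ∂κ
        = ∫ z, h (f z.1) * (g z.2 - f z.1) ∂κ + ∫ z, h (f z.2) * (g z.1 - f z.2) ∂κ
          - (∫ z, h (f z.1) * (g z.1 - f z.1) ∂κ + ∫ z, h (f z.2) * (g z.2 - f z.2) ∂κ) := by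
      rw [← integral_add j1 j2, ← integral_add j3 j4]
      refine Eq.trans ?_ (integral_sub (j1.add j2) (j3.add j4))
      refine integral_congr_ae (ae_of_all _ fun z => ?_)
      simp only
      ring
    dsimp only
    linarith

end Coupling

/-! ### Sublinearity and positivity of superquantiles -/

section RandomVariable

variable {Ω : Type*} [MeasurableSpace Ω] {P : Measure Ω} [IsProbabilityMeasure P] {Z W : Ω → ℝ}

omit [IsProbabilityMeasure P] in
lemma integrable_id_map (hZ : Measurable Z) (hZi : Integrable Z P) :
    Integrable (fun x => x) (P.map Z) :=
  (integrable_map_measure (by fun_prop) hZ.aemeasurable).2 hZi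

lemma superquantile_map_le (hZ : Measurable Z) (hZi : Integrable Z P) {α : ℝ}
    (hα : α ∈ Ioo (0 : ℝ) 1) (c : ℝ) :
    superquantile (P.map Z) α ≤ c * (1 - α) + ∫ ω, max (Z ω - c) 0 ∂P := by
  have := Measure.isProbabilityMeasure_map (μ := P) hZ.aemeasurable
  have h := superquantile_le (integrable_id_map hZ hZi) hα c
  rwa [integral_map hZ.aemeasurable (by fun_prop)] at h

lemma exists_superquantile_map_eq (hZ : Measurable Z) (hZi : Integrable Z P) {α : ℝ}
    (hα : α ∈ Ioo (0 : ℝ) 1) :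
    ∃ c, superquantile (P.map Z) α = c * (1 - α) + ∫ ω, max (Z ω - c) 0 ∂P := by
  have := Measure.isProbabilityMeasure_map (μ := P) hZ.aemeasurable
  obtain ⟨c, h⟩ := exists_superquantile_eq (integrable_id_map hZ hZi) hα
  refine ⟨c, ?_⟩
  rwa [integral_map hZ.aemeasurable (by fun_prop)] at h

lemma integrable_posPart_sub (hZi : Integrable Z P) (c : ℝ) :
    Integrable (fun ω => max (Z ω - c) 0) P :=
  (hZi.sub (integrable_const c)).pos_part

lemma superquantile_add_le (hZ : Measurable Z) (hZi : Integrable Z P) (hW : Measurable W)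
    (hWi : Integrable W P) {α : ℝ} (hα : α ∈ Ioo (0 : ℝ) 1) :
    superquantile (P.map fun ω => Z ω + W ω) α
      ≤ superquantile (P.map Z) α + superquantile (P.map W) α := by
  obtain ⟨c, hc⟩ := exists_superquantile_map_eq hZ hZi hα
  obtain ⟨d, hd⟩ := exists_superquantile_map_eq hW hWi hα
  -- The sum of the two minimizers is an admissible, possibly suboptimal, constant for `Z + W`.
  refine (superquantile_map_le (hZ.add hW) (hZi.add hWi) hα (c + d)).trans ?_
  have : ∫ ω, max (Z ω + W ω - (c + d)) 0 ∂P
      ≤ ∫ ω, (max (Z ω - c) 0 + max (W ω - d) 0) ∂P := by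
    refine integral_mono (integrable_posPart_sub (hZi.add hWi) _)
      ((integrable_posPart_sub hZi c).add (integrable_posPart_sub hWi d)) fun ω => ?_
    simp only
    refine max_le ?_ (add_nonneg (le_max_right _ _) (le_max_right _ _))
    linarith [le_max_left (Z ω - c) 0, le_max_left (W ω - d) 0]
  rw [integral_add (integrable_posPart_sub hZi c) (integrable_posPart_sub hWi d)] at this
  rw [hc, hd]
  simp only [Pi.add_apply]
  linarith

lemma superquantile_const_mul_le (hZ : Measurable Z) (hZi : Integrable Z P) {α : ℝ}
    (hα : α ∈ Ioo (0 : ℝ) 1) {r : ℝ} (hr : 0 ≤ r) :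
    superquantile (P.map fun ω => r * Z ω) α ≤ r * superquantile (P.map Z) α := by
  obtain ⟨c, hc⟩ := exists_superquantile_map_eq hZ hZi hα
  refine (superquantile_map_le (hZ.const_mul r) (hZi.const_mul r) hα (r * c)).trans_eq ?_
  have : ∀ ω, max (r * Z ω - r * c) 0 = r * max (Z ω - c) 0 := fun ω => by
    rw [mul_max_of_nonneg _ _ hr, mul_zero, mul_sub]
  simp only [this]
  rw [integral_const_mul, hc]
  ring

lemma superquantile_eq_zero_of_eq_zero {α : ℝ} (hα : α ∈ Ioo (0 : ℝ) 1) (h : ∀ ω, Z ω = 0) :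
    superquantile (P.map Z) α = 0 := by
  obtain rfl : Z = fun _ => 0 := funext h
  refine le_antisymm ?_ ?_
  · simpa using superquantile_map_le (P := P) measurable_const (integrable_const 0) hα 0
  · obtain ⟨c, hc⟩ := exists_superquantile_map_eq (P := P) measurable_const
      (integrable_const (0 : ℝ)) hα
    rw [hc]
    simp only [zero_sub, integral_const, probReal_univ, one_smul]
    rcases le_total c 0 with h | h
    · nlinarith [hα.1, le_max_left (-c) 0]
    · nlinarith [hα.2, le_max_right (-c) 0]

lemma superquantile_const_mul (hZ : Measurable Z) (hZi : Integrable Z P) {α : ℝ}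
    (hα : α ∈ Ioo (0 : ℝ) 1) {r : ℝ} (hr : 0 ≤ r) :
    superquantile (P.map fun ω => r * Z ω) α = r * superquantile (P.map Z) α := by
  rcases hr.eq_or_lt with rfl | hr'
  · rw [zero_mul]
    exact superquantile_eq_zero_of_eq_zero hα fun ω => zero_mul _
  -- The reverse inequality is the same one for the factor `r⁻¹` applied to `r * Z`.
  refine le_antisymm (superquantile_const_mul_le hZ hZi hα hr) ?_
  have h := superquantile_const_mul_le (hZ.const_mul r) (hZi.const_mul r) hα (inv_nonneg.2 hr)
  have e : (fun ω => r⁻¹ * (r * Z ω)) = Z := funext fun ω => inv_mul_cancel_left₀ hr'.ne' _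
  rw [e] at h
  rwa [inv_mul_eq_div, le_div_iff₀' hr'] at h

lemma superquantile_le_integral_abs (hZ : Measurable Z) (hZi : Integrable Z P) {α : ℝ}
    (hα : α ∈ Ioo (0 : ℝ) 1) : superquantile (P.map Z) α ≤ ∫ ω, |Z ω| ∂P := by
  refine (superquantile_map_le hZ hZi hα 0).trans ?_
  rw [zero_mul, zero_add]
  refine integral_mono (integrable_posPart_sub hZi 0) hZi.abs fun ω => ?_
  simp only [sub_zero]
  exact max_le (le_abs_self _) (abs_nonneg _)

/-- As `E Z = 0`, the superquantile is the mean of `(1 - α)(c - Z) + (Z - c)⁺`, which is nonnegative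
and vanishes only where `Z = c`. A zero mean would force `Z` to be constant, hence null. -/
lemma superquantile_pos (hZ : Measurable Z) (hZi : Integrable Z P) (hmean : ∫ ω, Z ω ∂P = 0)
    (hne : ¬ Z =ᵐ[P] 0) {α : ℝ} (hα : α ∈ Ioo (0 : ℝ) 1) : 0 < superquantile (P.map Z) α := by
  obtain ⟨c, hc⟩ := exists_superquantile_map_eq hZ hZi hα
  have hi : Integrable (fun ω => (1 - α) * (c - Z ω) + max (Z ω - c) 0) P :=
    (((integrable_const c).sub hZi).const_mul _).add (integrable_posPart_sub hZi c)
  have hint : ∫ ω, ((1 - α) * (c - Z ω) + max (Z ω - c) 0) ∂P = superquantile (P.map Z) α := by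
    have h1 : Integrable (fun ω => (1 - α) * (c - Z ω)) P :=
      ((integrable_const c).sub hZi).const_mul _
    rw [integral_add h1 (integrable_posPart_sub hZi c), integral_const_mul, integral_sub (integrable_const c) hZi, hmean, hc]
    simp [mul_comm]
  have key : ∀ x : ℝ, 0 ≤ (1 - α) * (c - x) + max (x - c) 0 ∧
      ((1 - α) * (c - x) + max (x - c) 0 = 0 → x = c) := by
    intro x
    have h1 := hα.1
    have h2 := sub_pos.2 hα.2
    rcases le_total x c with h | h
    · rw [max_eq_right (sub_nonpos.2 h), add_zero]
      refine ⟨mul_nonneg h2.le (sub_nonneg.2 h), fun h0 => ?_⟩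
      rcases mul_eq_zero.1 h0 with h0 | h0 <;> linarith
    · rw [max_eq_left (sub_nonneg.2 h)]
      have e : (1 - α) * (c - x) + (x - c) = α * (x - c) := by ring
      rw [e]
      refine ⟨mul_nonneg h1.le (sub_nonneg.2 h), fun h0 => ?_⟩
      rcases mul_eq_zero.1 h0 with h0 | h0 <;> linarith
  rw [← hint]
  refine lt_of_le_of_ne (integral_nonneg fun ω => (key _).1) fun h0 => hne ?_
  have hae := (integral_eq_zero_iff_of_nonneg (fun ω => (key (Z ω)).1) hi).1 h0.symm
  have hZc : Z =ᵐ[P] fun _ => c := hae.mono fun ω hω => (key _).2 hω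
  have hc0 : c = 0 := by
    have := integral_congr_ae hZc
    simpa [hmean] using this.symm
  rw [hc0] at hZc
  exact hZc

end RandomVariable

/-- Conditional Jensen for `x ↦ (x - c)⁺`, with `c` optimal for `W` and merely admissible for `Z`.
-/
lemma superquantile_le_of_condExp_eq {Ω : Type*} {m mΩ : MeasurableSpace Ω} {P : Measure Ω}
    [IsProbabilityMeasure P] {Z W : Ω → ℝ} (hZ : Measurable Z) (hZi : Integrable Z P)
    (hW : Measurable W) (hWi : Integrable W P) (hm : m ≤ mΩ)
    (h : P[W|m] =ᵐ[P] Z) {α : ℝ} (hα : α ∈ Ioo (0 : ℝ) 1) :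
    superquantile (P.map Z) α ≤ superquantile (P.map W) α := by
  obtain ⟨c, hc⟩ := exists_superquantile_map_eq hW hWi hα
  refine (superquantile_map_le hZ hZi hα c).trans ?_
  rw [hc, ← integral_condExp (f := fun ω => max (W ω - c) 0) hm]
  refine add_le_add le_rfl (integral_mono_ae (integrable_posPart_sub hZi c) integrable_condExp ?_)
  have h1 : P[W - (fun _ => c)|m] ≤ᵐ[P] P[fun ω => max (W ω - c) 0|m] :=
    condExp_mono (hWi.sub (integrable_const c)) (integrable_posPart_sub hWi c)
      (ae_of_all _ fun ω => le_max_left _ _)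
  have h2 : 0 ≤ᵐ[P] P[fun ω => max (W ω - c) 0|m] :=
    condExp_nonneg (ae_of_all _ fun ω => le_max_right _ _)
  filter_upwards [h, h1, h2, condExp_sub hWi (integrable_const c) m] with ω e0 e1 e2 e3
  rw [e3, Pi.sub_apply, condExp_const hm, e0] at e1
  exact max_le e1 e2

/-! ### Lifting a martingale coupling through a projection -/

section Disintegration

variable {E : Type*} [MeasurableSpace E]

lemma map_compProd_comap (ξ : Measure E) [IsProbabilityMeasure ξ] {z : E → ℝ} (hz : Measurable z)
    (K : Kernel ℝ ℝ) [IsMarkovKernel K] :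
    (ξ ⊗ₘ K.comap z hz).map (fun w => (z w.1, w.2)) = ξ.map z ⊗ₘ K := by
  have hT : Measurable fun w : E × ℝ => (z w.1, w.2) := by fun_prop
  ext s hs
  rw [Measure.map_apply hT hs, Measure.compProd_apply (hT hs), Measure.compProd_apply hs,
    lintegral_map (Kernel.measurable_kernel_prodMk_left hs) hz]
  rfl

/-- If `ρ` is a martingale coupling whose first marginal is the law of `z` under `ξ`, then there is
a kernel whose barycenter at `x` is `z x` and which transports `ξ` to the second marginal. -/
lemma exists_kernel_of_martingale (ξ : Measure E) [IsProbabilityMeasure ξ] {z : E → ℝ}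
    (hz : Measurable z) (hzi : Integrable z ξ) (ρ : Measure (ℝ × ℝ))
    (hρ1 : ρ.map Prod.fst = ξ.map z) (hρ2 : Integrable (fun y => y) (ρ.map Prod.snd))
    (hρ : ∀ h : ℝ → ℝ, Measurable h → (∀ x, |h x| ≤ 1) → ∫ z, h z.1 * (z.2 - z.1) ∂ρ = 0) :
    ∃ η : Kernel E ℝ, IsMarkovKernel η ∧ (ξ ⊗ₘ η).map Prod.snd = ρ.map Prod.snd ∧
      ∀ᵐ x ∂ξ, ∫ y, y ∂(η x) = z x := by
  have hprob : IsProbabilityMeasure ρ := by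
    refine ⟨?_⟩
    have h := congrArg (fun μ => μ univ) hρ1
    have := Measure.isProbabilityMeasure_map (μ := ξ) hz.aemeasurable
    simpa [Measure.map_apply measurable_fst] using h
  have hdis : ρ.map Prod.fst ⊗ₘ ρ.condKernel = ρ := ρ.disintegrate ρ.condKernel
  refine ⟨ρ.condKernel.comap z hz, inferInstance, ?_, ?_⟩
  · have h := map_compProd_comap ξ hz ρ.condKernel
    rw [← hρ1, hdis] at h
    conv_rhs => rw [← h]
    rw [Measure.map_map measurable_snd (by fun_prop)]
    rfl
  · have i2 : Integrable (fun w : ℝ × ℝ => w.2) ρ := hρ2.comp_measurable measurable_snd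
    have hi1 : Integrable (fun x => x) (ρ.map Prod.fst) := hρ1 ▸ integrable_id_map hz hzi
    have i1 : Integrable (fun w : ℝ × ℝ => w.1) ρ := hi1.comp_measurable measurable_fst
    have i21 : Integrable (fun w : ℝ × ℝ => w.2 - w.1) (ρ.map Prod.fst ⊗ₘ ρ.condKernel) := by
      rw [hdis]; exact i2.sub i1
    have ibar : Integrable (fun x => ∫ y, (y - x) ∂(ρ.condKernel x)) (ρ.map Prod.fst) :=
      i21.integral_compProd
    have hμ : IsProbabilityMeasure (ρ.map Prod.fst) :=
      Measure.isProbabilityMeasure_map measurable_fst.aemeasurable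
    -- Indicator test functions suffice to identify the barycenters of the conditional kernel.
    have h0 := ibar.ae_eq_zero_of_forall_setIntegral_eq_zero fun s hs _ => by
      have e := Measure.setIntegral_compProd hs MeasurableSet.univ (i21.integrableOn (s := s ×ˢ univ))
      simp only [Measure.restrict_univ] at e
      rw [← e, hdis, ← integral_indicator (hs.prod MeasurableSet.univ)]
      rw [← hρ (s.indicator 1) (measurable_one.indicator hs) fun x => by
        by_cases hx : x ∈ s <;> simp [hx]]
      refine integral_congr_ae (ae_of_all _ fun w => ?_)
      by_cases hx : w.1 ∈ s <;> simp [hx]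
    have hint : ∀ᵐ x ∂(ρ.map Prod.fst), Integrable (fun y => y) (ρ.condKernel x) := by
      have i2' : Integrable (fun w : ℝ × ℝ => w.2) (ρ.map Prod.fst ⊗ₘ ρ.condKernel) := by
        rwa [hdis]
      exact ((Measure.integrable_compProd_iff i2'.aestronglyMeasurable).1 i2').1
    have hbar : ∀ᵐ x ∂(ρ.map Prod.fst), ∫ y, y ∂(ρ.condKernel x) = x := by
      filter_upwards [h0, hint] with x hx hxi
      rw [integral_sub hxi (integrable_const x)] at hx
      simpa [sub_eq_zero] using hx
    rw [hρ1] at hbar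
    exact ae_of_ae_map hz.aemeasurable hbar

end Disintegration

/-! ### The identified set in terms of superquantiles -/

section IdentifiedSet

variable {p : ℕ}

/-- The law of `β ⬝ X₀` when `X` has law `ξ`. -/
noncomputable def projectionLaw (ξ : Measure (EuclideanSpace ℝ (Fin p)))
    (β : EuclideanSpace ℝ (Fin p)) : Measure ℝ :=
  ξ.map fun x => inner ℝ β (x - ∫ x', x' ∂ξ)

/-- The law of `Y₀` when `Y` has law `υ`. -/
noncomputable def centeredLaw (υ : Measure ℝ) : Measure ℝ :=
  υ.map fun y => y - ∫ y', y' ∂υ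

lemma map_inner_centered {Ω : Type*} [MeasurableSpace Ω] (P : Measure Ω)
    {X : Ω → EuclideanSpace ℝ (Fin p)} (hX : Measurable X) (β : EuclideanSpace ℝ (Fin p)) :
    P.map (fun ω => inner ℝ β (centered P X ω)) = projectionLaw (P.map X) β := by
  rw [projectionLaw, Measure.map_map (by fun_prop) hX,
    integral_map (f := fun x => x) hX.aemeasurable aestronglyMeasurable_id]
  rfl

lemma map_centered {Ω : Type*} [MeasurableSpace Ω] (P : Measure Ω) {Y : Ω → ℝ}
    (hY : Measurable Y) : P.map (centered P Y) = centeredLaw (P.map Y) := by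
  rw [centeredLaw, Measure.map_map (by fun_prop) hY,
    integral_map (f := fun y => y) hY.aemeasurable aestronglyMeasurable_id]
  rfl

variable {ξ : Measure (EuclideanSpace ℝ (Fin p))} [IsProbabilityMeasure ξ]
  {υ : Measure ℝ} [IsProbabilityMeasure υ]

lemma integrable_inner_sub_integral (hξ : Integrable (fun x => x) ξ)
    (β : EuclideanSpace ℝ (Fin p)) :
    Integrable (fun x => (inner ℝ β (x - ∫ x', x' ∂ξ) : ℝ)) ξ :=
  (hξ.sub (integrable_const _)).const_inner β

lemma integral_inner_sub_integral (hξ : Integrable (fun x => x) ξ)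
    (β : EuclideanSpace ℝ (Fin p)) :
    ∫ x, (inner ℝ β (x - ∫ x', x' ∂ξ) : ℝ) ∂ξ = 0 := by
  rw [integral_inner (f := fun x => x - ∫ x', x' ∂ξ) (hξ.sub (integrable_const _)),
    integral_sub hξ (integrable_const _)]
  simp

lemma superquantile_le_of_mem_identifiedSet (hξ : Integrable (fun x => x) ξ)
    (hυ : Integrable (fun y => y) υ) {β : EuclideanSpace ℝ (Fin p)}
    (hβ : β ∈ identifiedSet ξ υ) {α : ℝ} (hα : α ∈ Ioo (0 : ℝ) 1) :
    superquantile (projectionLaw ξ β) α ≤ superquantile (centeredLaw υ) α := by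
  obtain ⟨Ω', _, Q, X', Y', hQ, hX', hY', rfl, rfl, hcond⟩ := hβ
  have iX : Integrable X' Q := hξ.comp_measurable hX'
  have iY : Integrable Y' Q := hυ.comp_measurable hY'
  have mX : Measurable (centered Q X') := hX'.sub_const _
  have mY : Measurable (centered Q Y') := hY'.sub_const _
  rw [← map_inner_centered Q hX', ← map_centered Q hY']
  exact superquantile_le_of_condExp_eq (by fun_prop)
    ((iX.sub (integrable_const _)).const_inner β) mY (iY.sub (integrable_const _))
    mX.comap_le hcond hα

lemma mem_identifiedSet_of_superquantile_le (hξ : Integrable (fun x => x) ξ)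
    (hυ : Integrable (fun y => y) υ) {β : EuclideanSpace ℝ (Fin p)}
    (h : ∀ α ∈ Ioo (0 : ℝ) 1,
      superquantile (projectionLaw ξ β) α ≤ superquantile (centeredLaw υ) α) :
    β ∈ identifiedSet ξ υ := by
  set z : EuclideanSpace ℝ (Fin p) → ℝ := fun x => inner ℝ β (x - ∫ x', x' ∂ξ) with hzdef
  have hz : Measurable z := by fun_prop
  have hzi : Integrable z ξ := integrable_inner_sub_integral hξ β
  have hc : Measurable fun y : ℝ => y - ∫ y', y' ∂υ := by fun_prop
  have p1 : IsProbabilityMeasure (projectionLaw ξ β) :=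
    Measure.isProbabilityMeasure_map hz.aemeasurable
  have p2 : IsProbabilityMeasure (centeredLaw υ) :=
    Measure.isProbabilityMeasure_map hc.aemeasurable
  have i1 : Integrable (fun x => x) (projectionLaw ξ β) := integrable_id_map hz hzi
  have i2 : Integrable (fun x => x) (centeredLaw υ) :=
    integrable_id_map hc (hυ.sub (integrable_const _))
  have m1 : ∫ x, x ∂(projectionLaw ξ β) = 0 := by
    rw [projectionLaw, integral_map hz.aemeasurable (by fun_prop)]
    exact integral_inner_sub_integral hξ β
  have m2 : ∫ x, x ∂(centeredLaw υ) = 0 := by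
    rw [centeredLaw, integral_map hc.aemeasurable (by fun_prop), integral_sub hυ (integrable_const _)]
    simp
  obtain ⟨ρ, hρ1, hρ2, hρ⟩ := exists_martingale_coupling
    (measurable_unitQuantile (projectionLaw ξ β)) (measurable_unitQuantile (centeredLaw υ))
    (integrable_unitQuantile i1) (integrable_unitQuantile i2) (monotoneOn_unitQuantile _)
    (by rw [integral_unitQuantile, integral_unitQuantile, m1, m2])
    (fun u hu => by
      rw [← superquantile_eq_setIntegral hu, ← superquantile_eq_setIntegral hu]; exact h u hu)
  rw [map_unitQuantile] at hρ1 hρ2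
  obtain ⟨η, hη, hη2, hbar⟩ := exists_kernel_of_martingale ξ hz hzi ρ hρ1 (hρ2 ▸ i2) hρ
  rw [hρ2] at hη2
  set Q := ξ ⊗ₘ η with hQ
  have hQ1 : Q.map Prod.fst = ξ := Measure.fst_compProd ξ η
  have hY' : Measurable fun w : EuclideanSpace ℝ (Fin p) × ℝ => w.2 + ∫ y', y' ∂υ := by fun_prop
  have hQ2 : Q.map (fun w => w.2 + ∫ y', y' ∂υ) = υ := by
    have : (fun w : EuclideanSpace ℝ (Fin p) × ℝ => w.2 + ∫ y', y' ∂υ)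
        = (fun y => y + ∫ y', y' ∂υ) ∘ Prod.snd := rfl
    rw [this, ← Measure.map_map (by fun_prop) measurable_snd, hη2, centeredLaw,
      Measure.map_map (by fun_prop) hc]
    convert Measure.map_id
    ext y
    simp
  have cX : centered Q Prod.fst = fun w => w.1 - ∫ x, x ∂ξ := by
    funext w
    have : ∫ w : EuclideanSpace ℝ (Fin p) × ℝ, w.1 ∂Q = ∫ x, x ∂(Q.map Prod.fst) :=
      (integral_map measurable_fst.aemeasurable aestronglyMeasurable_id).symm
    rw [centered, this, hQ1]
  have cY : centered Q (fun w => w.2 + ∫ y', y' ∂υ) = Prod.snd := by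
    funext w
    have : ∫ w : EuclideanSpace ℝ (Fin p) × ℝ, (w.2 + ∫ y', y' ∂υ) ∂Q
        = ∫ y, y ∂(Q.map (fun w => w.2 + ∫ y', y' ∂υ)) :=
      (integral_map hY'.aemeasurable aestronglyMeasurable_id).symm
    rw [centered, this, hQ2]
    simp
  -- The kernel produces the centered outcome, so the mean of `υ` is added back to recover the law
  -- `υ`.
  refine ⟨EuclideanSpace ℝ (Fin p) × ℝ, inferInstance, Q, Prod.fst,
    fun w => w.2 + ∫ y', y' ∂υ, inferInstance, measurable_fst, hY', hQ1, hQ2, ?_⟩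
  rw [cX, cY]
  have mc : Measurable fun w : EuclideanSpace ℝ (Fin p) × ℝ => w.1 - ∫ x, x ∂ξ := by fun_prop
  have is : Integrable (fun w : EuclideanSpace ℝ (Fin p) × ℝ => w.2) Q := by
    have : Integrable (fun y => y) (Q.map Prod.snd) := hη2 ▸ i2
    exact this.comp_measurable measurable_snd
  have iz : Integrable (fun w : EuclideanSpace ℝ (Fin p) × ℝ => z w.1) Q := by
    have : Integrable z (Q.map Prod.fst) := hQ1 ▸ hzi
    exact this.comp_measurable measurable_fst
  refine (ae_eq_condExp_of_forall_setIntegral_eq mc.comap_le is (fun _ _ _ => iz.integrableOn)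
    ?_ ?_).symm
  · rintro _ ⟨t, ht, rfl⟩ -
    have hs : MeasurableSet ((fun x => x - ∫ x', x' ∂ξ) ⁻¹' t) :=
      (measurable_id.sub_const (∫ x', x' ∂ξ)) ht
    have e : (fun w : EuclideanSpace ℝ (Fin p) × ℝ => w.1 - ∫ x, x ∂ξ) ⁻¹' t
        = ((fun x => x - ∫ x', x' ∂ξ) ⁻¹' t) ×ˢ univ := by ext w; simp
    rw [e, hQ, Measure.setIntegral_compProd (f := fun w => inner ℝ β (w.1 - ∫ x, x ∂ξ)) hs
      MeasurableSet.univ iz.integrableOn,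
      Measure.setIntegral_compProd hs MeasurableSet.univ is.integrableOn]
    refine integral_congr_ae (ae_restrict_of_ae ?_)
    filter_upwards [hbar] with x hx
    simp [hx, hzdef]
  · have hcm : Measurable[MeasurableSpace.comap
        (fun w : EuclideanSpace ℝ (Fin p) × ℝ => w.1 - ∫ x, x ∂ξ) inferInstance]
        fun w : EuclideanSpace ℝ (Fin p) × ℝ => w.1 - ∫ x, x ∂ξ := comap_measurable _
    have hin : Measurable fun x : EuclideanSpace ℝ (Fin p) => (inner ℝ β x : ℝ) := by fun_prop
    exact (hin.comp hcm).aestronglyMeasurable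

theorem mem_identifiedSet_iff (hξ : Integrable (fun x => x) ξ)
    (hυ : Integrable (fun y => y) υ) {β : EuclideanSpace ℝ (Fin p)} :
    β ∈ identifiedSet ξ υ ↔ ∀ α ∈ Ioo (0 : ℝ) 1,
      superquantile (projectionLaw ξ β) α ≤ superquantile (centeredLaw υ) α :=
  ⟨fun h _ hα => superquantile_le_of_mem_identifiedSet hξ hυ h hα,
    mem_identifiedSet_of_superquantile_le hξ hυ⟩

end IdentifiedSet

/-! ### Convex geometry of the sublevel set -/

section Gauge

variable {p : ℕ}

/-- A family of positive definite continuous sublinear functionals indexed by `(0, 1)`. -/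
structure IsSublinearFamily (φ : EuclideanSpace ℝ (Fin p) → ℝ → ℝ) : Prop where
  add_le : ∀ q r, ∀ α ∈ Ioo (0 : ℝ) 1, φ (q + r) α ≤ φ q α + φ r α
  smul : ∀ (c : ℝ) q, 0 ≤ c → ∀ α ∈ Ioo (0 : ℝ) 1, φ (c • q) α = c * φ q α
  pos : ∀ q, q ≠ 0 → ∀ α ∈ Ioo (0 : ℝ) 1, 0 < φ q α
  exists_bound : ∃ C : ℝ≥0, ∀ q, ∀ α ∈ Ioo (0 : ℝ) 1, φ q α ≤ C * ‖q‖

/-- The set of points at which each functional `φ · α` is bounded by `b α`. -/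
def sublevelSet (φ : EuclideanSpace ℝ (Fin p) → ℝ → ℝ) (b : ℝ → ℝ) :
    Set (EuclideanSpace ℝ (Fin p)) :=
  {β | ∀ α ∈ Ioo (0 : ℝ) 1, φ β α ≤ b α}

/-- The radial function of `sublevelSet φ b`. -/
noncomputable def radialFn (φ : EuclideanSpace ℝ (Fin p) → ℝ → ℝ) (b : ℝ → ℝ)
    (q : EuclideanSpace ℝ (Fin p)) : ℝ :=
  ⨅ α : Ioo (0 : ℝ) 1, b α / φ q α

variable {φ : EuclideanSpace ℝ (Fin p) → ℝ → ℝ} {b : ℝ → ℝ}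

instance nonempty_Ioo_zero_one : Nonempty (Ioo (0 : ℝ) 1) := ⟨⟨1 / 2, by norm_num, by norm_num⟩⟩

namespace IsSublinearFamily

lemma apply_zero (h : IsSublinearFamily φ) {α : ℝ} (hα : α ∈ Ioo (0 : ℝ) 1) : φ 0 α = 0 := by
  simpa using h.smul 0 0 le_rfl α hα

lemma continuous (h : IsSublinearFamily φ) {α : ℝ} (hα : α ∈ Ioo (0 : ℝ) 1) :
    Continuous fun q => φ q α := by
  obtain ⟨C, hC⟩ := h.exists_bound
  refine (LipschitzWith.of_le_add_mul C fun q r => ?_).continuous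
  have h1 := h.add_le r (q - r) α hα
  rw [add_sub_cancel] at h1
  rw [dist_eq_norm]
  linarith [hC (q - r) α hα]

lemma isClosed_sublevelSet (h : IsSublinearFamily φ) : IsClosed (sublevelSet φ b) := by
  have : sublevelSet φ b = ⋂ α ∈ Ioo (0 : ℝ) 1, {q | φ q α ≤ b α} := by
    ext; simp [sublevelSet]
  rw [this]
  exact isClosed_biInter fun α hα => isClosed_le (h.continuous hα) continuous_const

lemma convex_sublevelSet (h : IsSublinearFamily φ) : Convex ℝ (sublevelSet φ b) := by
  intro β hβ γ hγ s t hs ht hst α hα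
  calc φ (s • β + t • γ) α ≤ s * φ β α + t * φ γ α := by
        rw [← h.smul s β hs α hα, ← h.smul t γ ht α hα]; exact h.add_le _ _ α hα
    _ ≤ s * b α + t * b α := by gcongr; exacts [hβ α hα, hγ α hα]
    _ = b α := by rw [← add_mul, hst, one_mul]

lemma zero_mem_sublevelSet (h : IsSublinearFamily φ) (hb : ∀ α ∈ Ioo (0 : ℝ) 1, 0 < b α) :
    0 ∈ sublevelSet φ b := fun α hα => (h.apply_zero hα).trans_le (hb α hα).le

/-- The single level `α = 1/2` already gives boundedness: `φ · (1/2)` is continuous and positive on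
the unit sphere, so it dominates a multiple of the norm. The sphere is empty when `p = 0`. -/
lemma isCompact_sublevelSet (h : IsSublinearFamily φ) : IsCompact (sublevelSet φ b) := by
  have hα : (1 / 2 : ℝ) ∈ Ioo (0 : ℝ) 1 := ⟨by norm_num, by norm_num⟩
  refine Metric.isCompact_of_isClosed_isBounded h.isClosed_sublevelSet ?_
  rcases (Metric.sphere (0 : EuclideanSpace ℝ (Fin p)) 1).eq_empty_or_nonempty with hS | hS
  · refine (Bornology.isBounded_singleton (x := (0 : EuclideanSpace ℝ (Fin p)))).subset
      fun β _ => ?_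
    by_contra hβ
    have : (‖β‖⁻¹ • β) ∈ Metric.sphere (0 : EuclideanSpace ℝ (Fin p)) 1 := by
      simp [norm_smul, inv_mul_cancel₀ (norm_ne_zero_iff.2 hβ)]
    rw [hS] at this
    exact this
  obtain ⟨q₀, hq₀, hmin⟩ := (isCompact_sphere (0 : EuclideanSpace ℝ (Fin p)) 1).exists_isMinOn hS
    (h.continuous hα).continuousOn
  have hq₀' : q₀ ≠ 0 := by
    rintro rfl
    simp at hq₀
  have hδ := h.pos q₀ hq₀' _ hα
  refine (Metric.isBounded_closedBall (x := 0) (r := max 0 (b (1 / 2) / φ q₀ (1 / 2)))).subset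
    fun β hβ => ?_
  rw [mem_closedBall_zero_iff]
  rcases eq_or_ne β 0 with rfl | hβ0
  · simp
  refine le_max_of_le_right ((le_div_iff₀ hδ).2 ?_)
  have hmem : (‖β‖⁻¹ • β) ∈ Metric.sphere (0 : EuclideanSpace ℝ (Fin p)) 1 := by
    simp [norm_smul, inv_mul_cancel₀ (norm_ne_zero_iff.2 hβ0)]
  have h1 : φ q₀ (1 / 2) ≤ φ (‖β‖⁻¹ • β) (1 / 2) := hmin hmem
  have h2 := h.smul ‖β‖ (‖β‖⁻¹ • β) (norm_nonneg _) _ hα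
  rw [smul_inv_smul₀ (norm_ne_zero_iff.2 hβ0)] at h2
  calc ‖β‖ * φ q₀ (1 / 2) ≤ ‖β‖ * φ (‖β‖⁻¹ • β) (1 / 2) := by gcongr
    _ = φ β (1 / 2) := h2.symm
    _ ≤ b (1 / 2) := hβ _ hα

lemma bddBelow_ratio (h : IsSublinearFamily φ) (hb : ∀ α ∈ Ioo (0 : ℝ) 1, 0 < b α)
    {q : EuclideanSpace ℝ (Fin p)} (hq : q ≠ 0) :
    BddBelow (range fun α : Ioo (0 : ℝ) 1 => b α / φ q α) :=
  ⟨0, by rintro _ ⟨α, rfl⟩; exact (div_pos (hb α α.2) (h.pos q hq α α.2)).le⟩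

lemma radialFn_nonneg (h : IsSublinearFamily φ) (hb : ∀ α ∈ Ioo (0 : ℝ) 1, 0 < b α)
    {q : EuclideanSpace ℝ (Fin p)} (hq : q ≠ 0) : 0 ≤ radialFn φ b q :=
  le_ciInf fun α => (div_pos (hb α α.2) (h.pos q hq α α.2)).le

lemma smul_mem_sublevelSet_iff (h : IsSublinearFamily φ) (hb : ∀ α ∈ Ioo (0 : ℝ) 1, 0 < b α)
    {q : EuclideanSpace ℝ (Fin p)} (hq : q ≠ 0) {c : ℝ} (hc : 0 ≤ c) :
    c • q ∈ sublevelSet φ b ↔ c ≤ radialFn φ b q := by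
  rw [radialFn, le_ciInf_iff (h.bddBelow_ratio hb hq), Subtype.forall]
  refine forall₂_congr fun α hα => ?_
  rw [h.smul c q hc α hα, le_div_iff₀ (h.pos q hq α hα)]

/-- Inversion turns the infimum of ratios into a supremum of functions sublinear in `q`, from which
convexity can be read off. The value `∞` corresponds to a radial function equal to `0`. -/
lemma inv_ofReal_radialFn (h : IsSublinearFamily φ) (hb : ∀ α ∈ Ioo (0 : ℝ) 1, 0 < b α)
    {q : EuclideanSpace ℝ (Fin p)} (hq : q ≠ 0) :
    (ENNReal.ofReal (radialFn φ b q))⁻¹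
      = ⨆ α : Ioo (0 : ℝ) 1, ENNReal.ofReal (φ q α / b α) := by
  have hinv : ∀ α : Ioo (0 : ℝ) 1,
      ENNReal.ofReal (φ q α / b α) = (ENNReal.ofReal (b α / φ q α))⁻¹ := fun α => by
    rw [← ENNReal.ofReal_inv_of_pos (div_pos (hb α α.2) (h.pos q hq α α.2)), inv_div]
  refine le_antisymm ?_ (iSup_le fun α => ?_)
  · set T := ⨆ α : Ioo (0 : ℝ) 1, ENNReal.ofReal (φ q α / b α)
    have hT : ∀ α : Ioo (0 : ℝ) 1, ENNReal.ofReal (φ q α / b α) ≤ T := fun α =>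
      le_iSup (fun α : Ioo (0 : ℝ) 1 => ENNReal.ofReal (φ q α / b α)) α
    have hT0 : T ≠ 0 := by
      obtain ⟨α⟩ := nonempty_Ioo_zero_one
      exact ((ENNReal.ofReal_pos.2 (div_pos (h.pos q hq α α.2) (hb α α.2))).trans_le (hT α)).ne'
    rw [ENNReal.inv_le_iff_inv_le, ENNReal.le_ofReal_iff_toReal_le (ENNReal.inv_ne_top.2 hT0)
      (h.radialFn_nonneg hb hq)]
    refine le_ciInf fun α => ENNReal.toReal_le_of_le_ofReal
      (div_pos (hb α α.2) (h.pos q hq α α.2)).le ?_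
    rw [ENNReal.inv_le_iff_inv_le, ← hinv]
    exact hT α
  · rw [hinv]
    exact ENNReal.inv_le_inv.2 (ENNReal.ofReal_le_ofReal (ciInf_le (h.bddBelow_ratio hb hq) α))

lemma supportFn_sublevelSet (h : IsSublinearFamily φ) (hb : ∀ α ∈ Ioo (0 : ℝ) 1, 0 < b α)
    (k : Fin p) {c : ℝ} (hc : c * c = 1) :
    supportFn (sublevelSet φ b) (c • EuclideanSpace.single k (1 : ℝ))
      = (((⨅ q ∈ {q : EuclideanSpace ℝ (Fin p) | q k = c},
          (ENNReal.ofReal (radialFn φ b q))⁻¹)⁻¹ : ℝ≥0∞) : EReal) := by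
  have hc0 : c ≠ 0 := by rintro rfl; simp at hc
  have hinner : ∀ β : EuclideanSpace ℝ (Fin p),
      (inner ℝ (c • EuclideanSpace.single k (1 : ℝ)) β : ℝ) = c * β k := fun β => by
    rw [real_inner_smul_left, EuclideanSpace.inner_single_left]; simp
  have hne : ∀ q : EuclideanSpace ℝ (Fin p), q k = c → q ≠ 0 := by
    rintro _ hq rfl
    exact hc0 hq.symm
  have hinv : (⨅ q ∈ {q : EuclideanSpace ℝ (Fin p) | q k = c},
      (ENNReal.ofReal (radialFn φ b q))⁻¹)⁻¹
      = ⨆ q ∈ {q : EuclideanSpace ℝ (Fin p) | q k = c}, ENNReal.ofReal (radialFn φ b q) := by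
    simp only [ENNReal.inv_iInf, inv_inv]
  rw [hinv]
  -- The origin belongs to the set, so points with `c * β k ≤ 0` do not affect the supremum.
  have h0 : 0 ≤ supportFn (sublevelSet φ b) (c • EuclideanSpace.single k (1 : ℝ)) := by
    refine le_iSup₂_of_le 0 (h.zero_mem_sublevelSet hb) ?_
    simp
  refine le_antisymm (iSup₂_le fun β hβ => ?_) ?_
  · rw [hinner]
    rcases le_or_gt (c * β k) 0 with hle | hpos
    · exact (EReal.coe_le_coe_iff.2 hle).trans (EReal.coe_ennreal_nonneg _)
    set r := c * β k with hr
    -- Dividing by `r = c * β k` lands on the hyperplane because `c = ±1` is its own inverse.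
    have hq : (r⁻¹ • β) k = c := by
      have hβk : β k ≠ 0 := fun h0 => by rw [hr, h0, mul_zero] at hpos; exact lt_irrefl _ hpos
      rw [PiLp.smul_apply, smul_eq_mul, hr]
      field_simp
      linarith
    have hmem : r • (r⁻¹ • β) ∈ sublevelSet φ b := by rwa [smul_inv_smul₀ hpos.ne']
    rw [h.smul_mem_sublevelSet_iff hb (hne _ hq) hpos.le] at hmem
    have h1 : ENNReal.ofReal r ≤ ⨆ q ∈ {q : EuclideanSpace ℝ (Fin p) | q k = c},
        ENNReal.ofReal (radialFn φ b q) :=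
      le_iSup₂_of_le (r⁻¹ • β) hq (ENNReal.ofReal_le_ofReal hmem)
    calc (r : EReal) = ((ENNReal.ofReal r : ℝ≥0∞) : EReal) := by
          rw [EReal.coe_ennreal_ofReal, max_eq_left hpos.le]
      _ ≤ _ := EReal.coe_ennreal_le_coe_ennreal_iff.2 h1
  · rw [← EReal.coe_toENNReal h0, EReal.coe_ennreal_le_coe_ennreal_iff]
    refine iSup₂_le fun q hq => ?_
    rw [← EReal.coe_ennreal_le_coe_ennreal_iff, EReal.coe_toENNReal h0, EReal.coe_ennreal_ofReal,
      max_eq_left (h.radialFn_nonneg hb (hne q hq))]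
    have hmem := (h.smul_mem_sublevelSet_iff hb (hne q hq) (h.radialFn_nonneg hb (hne q hq))).2 le_rfl
    refine le_iSup₂_of_le _ hmem ?_
    rw [hinner, PiLp.smul_apply, smul_eq_mul, show q k = c from hq]
    exact EReal.coe_le_coe_iff.2 (by linear_combination (-radialFn φ b q) * hc)

lemma convexOn_inv_ofReal_radialFn (h : IsSublinearFamily φ)
    (hb : ∀ α ∈ Ioo (0 : ℝ) 1, 0 < b α) (k : Fin p) {c : ℝ} (hc : c ≠ 0) :
    ConvexOn ℝ≥0 Set.univ (fun x : {j : Fin p // j ≠ k} → ℝ =>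
      (ENNReal.ofReal (radialFn φ b (fillCoord k c x)))⁻¹) := by
  have hne : ∀ x, fillCoord k c x ≠ 0 := fun x h0 => by
    have := congrArg (fun q : EuclideanSpace ℝ (Fin p) => q k) h0
    simp [fillCoord, hc] at this
  refine ⟨convex_univ, fun x _ y _ s t _ _ hst => ?_⟩
  have hfill : fillCoord k c (s • x + t • y)
      = (s : ℝ) • fillCoord k c x + (t : ℝ) • fillCoord k c y := by
    ext j
    simp only [fillCoord, PiLp.add_apply, PiLp.smul_apply, smul_eq_mul]
    split_ifs with hj
    · rw [← add_mul, ← NNReal.coe_add, hst, NNReal.coe_one, one_mul]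
    · rfl
  simp only
  rw [h.inv_ofReal_radialFn hb (hne _), h.inv_ofReal_radialFn hb (hne _),
    h.inv_ofReal_radialFn hb (hne _), hfill]
  refine iSup_le fun α => ?_
  have key : φ ((s : ℝ) • fillCoord k c x + (t : ℝ) • fillCoord k c y) α / b α
      ≤ s * (φ (fillCoord k c x) α / b α) + t * (φ (fillCoord k c y) α / b α) := by
    rw [← mul_div_assoc, ← mul_div_assoc, ← add_div, ← h.smul _ _ s.coe_nonneg α α.2,
      ← h.smul _ _ t.coe_nonneg α α.2]
    exact div_le_div_of_nonneg_right (h.add_le _ _ α α.2) (hb α α.2).le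
  have hterm : ∀ z, 0 ≤ φ (fillCoord k c z) α / b α := fun z =>
    (div_pos (h.pos _ (hne z) α α.2) (hb α α.2)).le
  refine (ENNReal.ofReal_le_ofReal key).trans ?_
  rw [ENNReal.ofReal_add (mul_nonneg s.coe_nonneg (hterm x)) (mul_nonneg t.coe_nonneg (hterm y)),
    ENNReal.ofReal_mul s.coe_nonneg, ENNReal.ofReal_mul t.coe_nonneg, ENNReal.ofReal_coe_nnreal,
    ENNReal.ofReal_coe_nnreal, ENNReal.smul_def, ENNReal.smul_def, smul_eq_mul, smul_eq_mul]
  gcongr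
  · exact le_iSup (fun α : Ioo (0 : ℝ) 1 => ENNReal.ofReal (φ (fillCoord k c x) α / b α)) α
  · exact le_iSup (fun α : Ioo (0 : ℝ) 1 => ENNReal.ofReal (φ (fillCoord k c y) α / b α)) α

end IsSublinearFamily

lemma image_componentSet_eq_Icc {B : Set (EuclideanSpace ℝ (Fin p))} (hcomp : IsCompact B)
    (hconv : Convex ℝ B) (hne : B.Nonempty) (k : Fin p) :
    (fun b : ℝ => (b : EReal)) '' componentSet B k
      = Icc (-supportFn B (-EuclideanSpace.single k (1 : ℝ)))
          (supportFn B (EuclideanSpace.single k (1 : ℝ))) := by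
  have hS : componentSet B k = (fun β : EuclideanSpace ℝ (Fin p) => β k) '' B := rfl
  have hcont : Continuous fun β : EuclideanSpace ℝ (Fin p) => β k := by fun_prop
  have hIcc : componentSet B k = Icc (sInf (componentSet B k)) (sSup (componentSet B k)) :=
    eq_Icc_of_connected_compact
      (hS ▸ (hconv.isConnected hne).image _ hcont.continuousOn) (hS ▸ hcomp.image hcont)
  generalize sInf (componentSet B k) = lo at hIcc
  generalize sSup (componentSet B k) = hi at hIcc
  have hlh : lo ≤ hi := by
    rw [← nonempty_Icc, ← hIcc, hS]
    exact hne.image _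
  obtain ⟨βlo, hβlo, rfl⟩ : lo ∈ componentSet B k := hIcc ▸ left_mem_Icc.2 hlh
  obtain ⟨βhi, hβhi, rfl⟩ : hi ∈ componentSet B k := hIcc ▸ right_mem_Icc.2 hlh
  have hmem : ∀ β ∈ B, β k ∈ Icc (βlo k) (βhi k) := fun β hβ => hIcc ▸ ⟨β, hβ, rfl⟩
  have h1 : supportFn B (EuclideanSpace.single k (1 : ℝ)) = ((βhi k : ℝ) : EReal) := by
    refine le_antisymm (iSup₂_le fun β hβ => ?_) (le_iSup₂_of_le βhi hβhi ?_)
    · simpa [EuclideanSpace.inner_single_left] using (hmem β hβ).2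
    · simp [EuclideanSpace.inner_single_left]
  have h2 : supportFn B (-EuclideanSpace.single k (1 : ℝ)) = ((-βlo k : ℝ) : EReal) := by
    refine le_antisymm (iSup₂_le fun β hβ => ?_) (le_iSup₂_of_le βlo hβlo ?_)
    · rw [EReal.coe_le_coe_iff]
      simpa [EuclideanSpace.inner_single_left] using (hmem β hβ).1
    · simp [EuclideanSpace.inner_single_left]
  rw [h1, h2, ← EReal.coe_neg, neg_neg, hIcc, EReal.image_coe_Icc]

lemma iInf_fillCoord (k : Fin p) (c : ℝ) (F : EuclideanSpace ℝ (Fin p) → ℝ≥0∞) :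
    ⨅ q ∈ {q : EuclideanSpace ℝ (Fin p) | q k = c}, F q = ⨅ x, F (fillCoord k c x) := by
  refine le_antisymm (le_iInf fun x => iInf₂_le _ ?_) (le_iInf₂ fun q hq => ?_)
  · simp [fillCoord]
  · refine iInf_le_of_le (fun j => q j) (le_of_eq (congrArg F ?_))
    ext j
    by_cases hj : j = k
    · subst hj
      simpa [fillCoord] using (show q j = c from hq).symm
    · simp [fillCoord, hj]

end Gauge

/-! ### Consequences of nondegenerate variances -/

section Nondegenerate

variable {Ω : Type*} [MeasurableSpace Ω] {P : Measure Ω} [IsProbabilityMeasure P] {p : ℕ}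

/-- If `q ⬝ X₀` vanished almost surely, its covariance with each coordinate would be zero, placing
`q` in the kernel of `V(X)`. -/
lemma not_ae_eq_zero_of_isUnit_covMatrix {X : Ω → EuclideanSpace ℝ (Fin p)}
    (hX2 : MemLp X 2 P) (hVX : IsUnit (covMatrix P X))
    {q : EuclideanSpace ℝ (Fin p)} (hq : q ≠ 0) :
    ¬ (fun ω => (inner ℝ q (centered P X ω) : ℝ)) =ᵐ[P] 0 := by
  intro h0
  have hXi : Integrable X P := hX2.integrable (by norm_num)
  have hcoord : ∀ i, MemLp (fun ω => X ω i) 2 P := fun i =>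
    hX2.continuousLinearMap_comp (EuclideanSpace.proj (𝕜 := ℝ) i)
  have hmean : ∀ i, (∫ ω, X ω ∂P) i = ∫ ω, X ω i ∂P := fun i =>
    ((EuclideanSpace.proj (𝕜 := ℝ) i).integral_comp_comm hXi).symm
  have hcent : ∀ i, MemLp (fun ω => X ω i - ∫ ω', X ω' i ∂P) 2 P := fun i =>
    (hcoord i).sub (memLp_const _)
  have hV : Matrix.mulVec (covMatrix P X) q = 0 := by
    funext i
    simp only [Matrix.mulVec, dotProduct, covMatrix, Matrix.of_apply, covariance, Pi.zero_apply]
    simp_rw [← integral_mul_const]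
    have hij : ∀ j, Integrable (fun ω => (X ω i - ∫ ω', X ω' i ∂P) *
        (X ω j - ∫ ω', X ω' j ∂P) * q j) P := fun j =>
      ((hcent i).integrable_mul (hcent j)).mul_const (q j)
    rw [← integral_finsetSum _ fun j _ => hij j]
    refine integral_eq_zero_of_ae ?_
    filter_upwards [h0] with ω hω
    have hω' : ∑ j, (X ω j - ∫ ω', X ω' j ∂P) * q j = 0 := by
      rw [PiLp.inner_apply] at hω
      simpa [centered, hmean] using hω
    simp only [mul_assoc, ← Finset.mul_sum, hω', mul_zero, Pi.zero_apply]
  refine hq ?_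
  have hinj := Matrix.mulVec_injective_of_isUnit hVX
  have : (q : Fin p → ℝ) = 0 := hinj (by rw [hV, Matrix.mulVec_zero])
  ext i
  exact congrFun this i

lemma isSublinearFamily_superquantile {X : Ω → EuclideanSpace ℝ (Fin p)} (hX : Measurable X)
    (hX2 : MemLp X 2 P) (hVX : IsUnit (covMatrix P X)) :
    IsSublinearFamily fun q α =>
      superquantile (P.map fun ω => inner ℝ q (centered P X ω)) α := by
  have hXi : Integrable X P := hX2.integrable (by norm_num)
  have mC : Measurable (centered P X) := hX.sub_const _
  have iC : Integrable (centered P X) P := hXi.sub (integrable_const _)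
  have mq : ∀ q : EuclideanSpace ℝ (Fin p),
      Measurable fun ω => (inner ℝ q (centered P X ω) : ℝ) := fun q => by fun_prop
  have iq : ∀ q : EuclideanSpace ℝ (Fin p),
      Integrable (fun ω => (inner ℝ q (centered P X ω) : ℝ)) P := fun q => iC.const_inner q
  refine ⟨fun q r α hα => ?_, fun c q hc α hα => ?_, fun q hq α hα => ?_, ?_⟩
  · simp only [inner_add_left]
    exact superquantile_add_le (mq q) (iq q) (mq r) (iq r) hα
  · simp only [real_inner_smul_left]
    exact superquantile_const_mul (mq q) (iq q) hα hc
  · refine superquantile_pos (mq q) (iq q) ?_ (not_ae_eq_zero_of_isUnit_covMatrix hX2 hVX hq) hα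
    have hmean : ∫ ω, centered P X ω ∂P = 0 := by
      simp only [centered]
      rw [integral_sub hXi (integrable_const _)]
      simp
    rw [integral_inner iC, hmean, inner_zero_right]
  · refine ⟨(∫ ω, ‖centered P X ω‖ ∂P).toNNReal,
      fun q α hα => (superquantile_le_integral_abs (mq q) (iq q) hα).trans ?_⟩
    rw [Real.coe_toNNReal _ (integral_nonneg fun _ => norm_nonneg _), mul_comm, ← integral_const_mul]
    exact integral_mono (iq q).abs (iC.norm.const_mul _) fun ω => abs_real_inner_le_norm _ _

lemma superquantile_centered_pos {Y : Ω → ℝ} (hY : Measurable Y) (hY2 : MemLp Y 2 P)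
    (hVY : 0 < variance Y P) {α : ℝ} (hα : α ∈ Ioo (0 : ℝ) 1) :
    0 < superquantile (P.map (centered P Y)) α := by
  have hYi : Integrable Y P := hY2.integrable (by norm_num)
  refine superquantile_pos (hY.sub_const _) (hYi.sub (integrable_const _)) ?_ (fun h0 => ?_) hα
  · rw [integral_sub hYi (integrable_const _)]
    simp
  · rw [variance_eq_integral hY.aemeasurable] at hVY
    refine hVY.ne' (integral_eq_zero_of_ae ?_)
    filter_upwards [h0] with ω hω
    have hω' : Y ω - ∫ ω', Y ω' ∂P = 0 := hω
    simp [hω']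

end Nondegenerate

end DataCombination

/-! ### Assembly -/

open DataCombination in
theorem corollary1 {Ω : Type*} [MeasurableSpace Ω] (P : Measure Ω) [IsProbabilityMeasure P]
    {p : ℕ} (X : Ω → EuclideanSpace ℝ (Fin p)) (Y : Ω → ℝ)
    (hX : Measurable X) (hY : Measurable Y)
    (hX2 : MemLp X 2 P) (hY2 : MemLp Y 2 P)
    (hVY : 0 < variance Y P) (hVX : IsUnit (DataCombination.covMatrix P X))
    (α₀ : ℝ) (β₀ : EuclideanSpace ℝ (Fin p))
    (hmodel : P[Y | MeasurableSpace.comap X inferInstance]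
      =ᵐ[P] fun ω => α₀ + inner ℝ β₀ (X ω))
    (k : Fin p) :
    -- The identified set of the `k`-th component is the compact interval `[-σ(-e_k), σ(e_k)]`.
    (fun b : ℝ => (b : EReal)) ''
        DataCombination.componentSet (DataCombination.identifiedSet (P.map X) (P.map Y)) k
      = Set.Icc
          (-DataCombination.supportFn (DataCombination.identifiedSet (P.map X) (P.map Y))
            (-EuclideanSpace.single k (1 : ℝ)))
          (DataCombination.supportFn (DataCombination.identifiedSet (P.map X) (P.map Y))
            (EuclideanSpace.single k (1 : ℝ))) ∧
    -- The formula for `σ(e_k)`.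
    DataCombination.supportFn (DataCombination.identifiedSet (P.map X) (P.map Y))
        (EuclideanSpace.single k (1 : ℝ))
      = (((⨅ q ∈ {q : EuclideanSpace ℝ (Fin p) | q k = 1},
          DataCombination.invRadial P X Y q)⁻¹ : ℝ≥0∞) : EReal) ∧
    -- The formula for `σ(-e_k)`.
    DataCombination.supportFn (DataCombination.identifiedSet (P.map X) (P.map Y))
        (-EuclideanSpace.single k (1 : ℝ))
      = (((⨅ q ∈ {q : EuclideanSpace ℝ (Fin p) | q k = -1},
          DataCombination.invRadial P X Y q)⁻¹ : ℝ≥0∞) : EReal) ∧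
    -- Both infima are unconstrained minimizations of convex functions on `ℝ^(p-1)`.
    ∀ c : ℝ, c = 1 ∨ c = -1 →
      (⨅ q ∈ {q : EuclideanSpace ℝ (Fin p) | q k = c}, DataCombination.invRadial P X Y q)
        = (⨅ x : {j : Fin p // j ≠ k} → ℝ,
            DataCombination.invRadial P X Y (DataCombination.fillCoord k c x)) ∧
      ConvexOn ℝ≥0 Set.univ (fun x : {j : Fin p // j ≠ k} → ℝ =>
        DataCombination.invRadial P X Y (DataCombination.fillCoord k c x)) := by
  have hφ := isSublinearFamily_superquantile hX hX2 hVX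
  have hb : ∀ α ∈ Set.Ioo (0 : ℝ) 1, 0 < superquantile (P.map (centered P Y)) α :=
    fun α hα => superquantile_centered_pos hY hY2 hVY hα
  have hXi : Integrable X P := hX2.integrable (by norm_num)
  have hYi : Integrable Y P := hY2.integrable (by norm_num)
  set φ : EuclideanSpace ℝ (Fin p) → ℝ → ℝ := fun q α =>
    superquantile (P.map fun ω => inner ℝ q (centered P X ω)) α with hφdef
  set b : ℝ → ℝ := fun α => superquantile (P.map (centered P Y)) α with hbdef
  -- With this identification `invRadial` unfolds to the reciprocal of `radialFn φ b`, so the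
  -- geometric lemmas apply directly.
  have hB : identifiedSet (P.map X) (P.map Y) = sublevelSet φ b := by
    have := Measure.isProbabilityMeasure_map (μ := P) hX.aemeasurable
    have := Measure.isProbabilityMeasure_map (μ := P) hY.aemeasurable
    ext β
    rw [mem_identifiedSet_iff
      ((integrable_map_measure aestronglyMeasurable_id hX.aemeasurable).2 hXi)
      ((integrable_map_measure aestronglyMeasurable_id hY.aemeasurable).2 hYi),
      ← map_inner_centered P hX, ← map_centered P hY]
    rfl
  have g1 := image_componentSet_eq_Icc hφ.isCompact_sublevelSet (hφ.convex_sublevelSet)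
    ⟨0, hφ.zero_mem_sublevelSet hb⟩ k
  have h1 := hφ.supportFn_sublevelSet hb k (c := 1) (by norm_num)
  have h2 := hφ.supportFn_sublevelSet hb k (c := -1) (by norm_num)
  rw [one_smul] at h1
  rw [neg_one_smul] at h2
  refine ⟨?_, ?_, ?_, fun c hc => ⟨iInf_fillCoord k c _, ?_⟩⟩
  · rw [hB]; exact g1
  · rw [hB]; exact h1
  · rw [hB]; exact h2
  · refine hφ.convexOn_inv_ofReal_radialFn hb k ?_
    rcases hc with rfl | rfl <;> norm_num
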